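/- Let $n\ge 2$ be an integer and $\alpha>0$, and let $X_1,\dots,X_n$ be independent random variables with density $x^{\alpha-1}e^{-x}/\Gamma(\alpha)$ on $(0,\infty)$. Let $\bar X=\frac1n\sum_{i=1}^n X_i$, $S^2=\frac1{n-1}\sum_{i=1}^n (X_i-\bar X)^2$, and let $\Phi$ be the Euclidean angle between $(X_1,\dots,X_n)$ and $(1,\dots,1)$. For $a>0$, $x\ge 0$ write $G_a(x)=\int_0^x \xi^{a-1}e^{-\xi}\,d\xi/\Gamma(a)$, for real $x$ and $j\in\mathbb N_0$ write $\binom{x}{j}=x(x-1)\cdots(x-j+1)/j!$, and for $k,m\in\mathbb N_0$ put $$\mu_{\alpha,n,k}=\mathcal E\big((\sqrt n\cos\Phi)^{\alpha n+k}\big),\qquad H_{\alpha,n,m}(r)=\mathcal E\big(G_{\alpha n+m}(r\sqrt n\cos\Phi)\big).$$ Then the functions $z\mapsto H_{\alpha,n,m}(\sqrt z)$ are infinitely differentiable on $(0,\infty)$, and the following holds. (i) For $r>0$ and $z=r^2$, $$\Pr\{(n-1)S^2\le z\}=\sum_{j=0}^\infty \frac{\Gamma(\alpha n+2j)}{\Gamma(\alpha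 n)\,j!\,n^j}\Big(\frac{d}{dz}\Big)^j H_{\alpha,n,2j}(\sqrt z).$$ This series converges absolutely, and its terms are $O(j^{-(n+1)/2})$ with a constant depending only on $\alpha$ and $n$; that is, there is $C=C(\alpha,n)$ such that the $j$-th term is at most $C\,j^{-(n+1)/2}$ in absolute value for all $j\ge 1$ and all $z>0$. (ii) For $r\ge 0$ and $z=r^2$, $$\Pr\{(n-1)S^2\le z\}=\frac{r^{\alpha n}}{\Gamma(\alpha n)}\sum_{j=0}^\infty\left(\sum_{k=0}^\infty \binom{(\alpha n+k)/2+j-1}{j}\frac{\mu_{\alpha,n,2j+k}}{\alpha n+k}\,\frac{(-r)^k}{k!}\right)\frac1{n^j}.$$ (iii) For $r\ge 0$, $z=r^2$ and every $\lambda>0$, $$\Pr\{(n-1)S^2\le z\}=\sum_{j=0}^\infty\left(\sum_{k=0}^\infty \delta_{\alpha,n,j,k,\lambda}\binom{\alpha n+k-1}{k}G_{\alpha n+k}(\lambda r)\right)\Big(\frac{\lambda^2}{n}\Big)^j,$$ where $$\delta_{\alpha,n,j,k,\lambda}=\sum_{\ell=0}^k(-1)^\ell\binom k\ell\binom{(\alpha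 n+\ell)/2+j-1}{j}\frac{\mu_{\alpha,n,2j+\ell}}{\lambda^{\alpha n+2j+\ell}}.$$ In (ii) and (iii) the iterated series converge in the stated order: each inner series over $k$ converges absolutely, and then the outer series over $j$ converges absolutely. -/

import Mathlib

open MeasureTheory ProbabilityTheory

namespace GammaSample

noncomputable section

/-- The cdf `G_a(x) = ∫_0^x ξ^(a-1) e^(-ξ) / Γ(a) dξ` (`x ≥ 0`) of the gamma distribution of
order `a > 0` (and scale one). -/
def gammaCdf (a x : ℝ) : ℝ :=
  ∫ ξ in (0 : ℝ)..x, ξ ^ (a - 1) * Real.exp (-ξ) / Real.Gamma a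

/-- The generalized binomial coefficient `x (x-1) ⋯ (x-j+1) / j!` with a real upper entry. -/
abbrev binom (x : ℝ) (j : ℕ) : ℝ := Ring.choose x j

/-- The sample mean of `x_1, …, x_n`. -/
def sampleMean {n : ℕ} (x : Fin n → ℝ) : ℝ := (∑ i, x i) / n

/-- The sample variance `S² = (n-1)⁻¹ ∑ (x_i - x̄)²`. -/
def sampleVariance {n : ℕ} (x : Fin n → ℝ) : ℝ :=
  ((n : ℝ) - 1)⁻¹ * ∑ i, (x i - sampleMean x) ^ 2

/-- The Euclidean angle `Φ` between `(x_1, …, x_n)` and `(1, …, 1)`. -/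
def diagAngle {n : ℕ} (x : Fin n → ℝ) : ℝ :=
  InnerProductGeometry.angle (WithLp.toLp 2 x : EuclideanSpace ℝ (Fin n))
    (WithLp.toLp 2 fun _ => 1)

section

variable {Ω : Type*} [MeasurableSpace Ω] (P : Measure Ω) {n : ℕ} (X : Fin n → Ω → ℝ) (α : ℝ)

/-- The moments `μ_{α,n,k} = E((√n cos Φ)^(αn+k))`, where `Φ` is the angle between
`(X_1, …, X_n)` and `(1, …, 1)`. -/
def angleMoment (k : ℕ) : ℝ :=
  ∫ ω, (√(n : ℝ) * Real.cos (diagAngle fun i => X i ω)) ^ (α * n + k) ∂P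

/-- The functions `H_{α,n,m}(r) = E(G_{αn+m}(r √n cos Φ))`. -/
def H (m : ℕ) (r : ℝ) : ℝ :=
  ∫ ω, gammaCdf (α * n + m) (r * √(n : ℝ) * Real.cos (diagAngle fun i => X i ω)) ∂P

/-- The `j`-th term of the Taylor type series,
`Γ(αn+2j) / (Γ(αn) j! n^j) (d/dz)^j H_{α,n,2j}(√z)`. -/
def taylorTerm (j : ℕ) (z : ℝ) : ℝ :=
  Real.Gamma (α * n + 2 * j) / (Real.Gamma (α * n) * (j.factorial : ℝ) * (n : ℝ) ^ j) *
    iteratedDeriv j (fun y => H P X α (2 * j) (√y)) z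

/-- The `k`-th term of the `j`-th inner series of the double power series,
`binom((αn+k)/2 + j - 1, j) μ_{α,n,2j+k} / (αn+k) (-r)^k / k!`. -/
def powerTerm (j k : ℕ) (r : ℝ) : ℝ :=
  binom ((α * n + k) / 2 + j - 1) j * (angleMoment P X α (2 * j + k) / (α * n + k)) *
    ((-r) ^ k / (k.factorial : ℝ))

/-- The alternating `k`-th order differences `δ_{α,n,j,k,λ}`, i.e. the sum over `0 ≤ l ≤ k` of
`(-1)^l binom(k, l) binom((αn+l)/2 + j - 1, j) μ_{α,n,2j+l} / λ^(αn+2j+l)`. -/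
def altDiff (j k : ℕ) (lam : ℝ) : ℝ :=
  ∑ l ∈ Finset.range (k + 1), (-1 : ℝ) ^ l * (k.choose l : ℝ) *
    binom ((α * n + l) / 2 + j - 1) j *
    (angleMoment P X α (2 * j + l) / lam ^ (α * n + 2 * j + l))

/-- The `k`-th term of the `j`-th inner series of gamma cdfs,
`δ_{α,n,j,k,λ} binom(αn+k-1, k) G_{αn+k}(λ r)`. -/
def mixtureTerm (lam : ℝ) (j k : ℕ) (r : ℝ) : ℝ :=
  altDiff P X α j k lam * binom (α * n + k - 1) k * gammaCdf (α * n + k) (lam * r)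

end

end

end GammaSample

open GammaSample

namespace GammaSample

noncomputable section

open Filter Topology
open scoped ENNReal

/-! Write `T` for the sum of the coordinates, `V = √n cos Φ = T / ‖X‖` and `w = V²/n`. Then `(n-1)S²
= ‖X‖² - T²/n = T² (1 - w) / V²`, so for `r ≥ 0` the event `(n-1)S² ≤ r²` is `T ≤ r V / √(1 - w)`.
For a gamma sample `T` has the gamma law of order `αn` and is independent of the scale invariant
`V`; hence the probability is the expectation of `G_{αn}(r V / √(1 - w))`.

With `a = αn`, the function `Γ(a) G_a(x / √(1 - w))` is expanded in powers of `w`. Its coefficients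
`innerSeries a j x` come from integrating the exponential series and expanding each `(1 -
w)^(-(a+k)/2)` binomially. Taking expectations termwise yields one outer series, with terms
`outerTerm`; the Taylor, power and gamma cdf series all have these same outer terms.

The interchange of expectation and sum, and the rate `j^(-(n+1)/2)`, rest on two estimates. The
coefficients are `O(1/j)` uniformly in `x` (`exists_abs_innerSeries_le`), by Cauchy's formula for
the `w`-derivative, whose mean modulus on circles inside the unit disc is bounded independently of
`x`. The moments of `w` are `O(j^(-(n-1)/2))` (`exists_integral_diagRatio_pow_le`), because `1 - w ≤
ε` forces `n - 1` coordinates into windows of relative width of order `√ε` around the remaining one.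
Since `n ≥ 2`, the product of the two bounds is summable. -/

theorem hasSum_of_eq {ι E : Type*} [AddCommMonoid E] [TopologicalSpace E] {f g : ι → E} {x y : E}
    (h : HasSum f x) (hfg : ∀ i, g i = f i) (hxy : y = x) : HasSum g y := by
  rw [hxy, funext hfg]
  exact h

/-! ### Binomial series and binomial coefficients with real upper entry. -/

theorem hasSum_choose_mul_pow (p : ℂ) {s : ℂ} (hs : ‖s‖ < 1) :
    HasSum (fun j : ℕ => Ring.choose (p + j - 1) j * s ^ j) ((1 - s) ^ (-p)) := by
  have h := (Complex.one_div_one_sub_cpow_hasFPowerSeriesOnBall_zero p).hasSum (y := s)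
    (by simpa [enorm_eq_nnnorm, ← NNReal.coe_lt_coe] using hs)
  simpa [FormalMultilinearSeries.ofScalars_apply_eq, Complex.cpow_neg, mul_comm] using h

theorem hasSum_real_choose_mul_pow (p : ℝ) {s : ℝ} (hs : |s| < 1) :
    HasSum (fun j : ℕ => Ring.choose (p + j - 1) j * s ^ j) ((1 - s) ^ (-p)) := by
  have h := (Real.one_div_one_sub_rpow_hasFPowerSeriesOnBall_zero p).hasSum (y := s)
    (by simpa [enorm_eq_nnnorm, ← NNReal.coe_lt_coe] using hs)
  rw [Real.rpow_neg (by linarith [(abs_lt.1 hs).2])]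
  simpa [FormalMultilinearSeries.ofScalars_apply_eq, mul_comm] using h

theorem choose_eq_ascPochhammer (p : ℝ) (j : ℕ) :
    (j.factorial : ℝ) * binom (p + j - 1) j = (ascPochhammer ℝ j).eval p := by
  have h := Ring.factorial_nsmul_multichoose_eq_ascPochhammer p j
  rw [Ring.multichoose_eq, Polynomial.ascPochhammer_smeval_eq_eval] at h
  simpa using h

theorem choose_nonneg {p : ℝ} (hp : 0 < p) (j : ℕ) : 0 ≤ binom (p + j - 1) j := by
  have h := choose_eq_ascPochhammer p j
  have h2 := ascPochhammer_pos j p hp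
  rw [← h] at h2
  exact (pos_of_mul_pos_right h2 (by positivity)).le

/-- A single term of the nonnegative binomial series at `1/2` is at most its sum `2^p`. Growth that
is only exponential in `p` is later beaten by `1/k!`. -/
theorem choose_le {p : ℝ} (hp : 0 < p) (j : ℕ) : binom (p + j - 1) j ≤ 2 ^ (j + p) := by
  have h := hasSum_real_choose_mul_pow p (s := 1 / 2) (by norm_num [abs_of_pos])
  have h2 := le_hasSum h j fun i _ => mul_nonneg (choose_nonneg hp i) (by positivity)
  rw [Real.rpow_add (by norm_num), Real.rpow_natCast]
  have h3 : ((1 : ℝ) - 1 / 2) ^ (-p) = 2 ^ p := by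
    rw [Real.rpow_neg (by norm_num), ← Real.inv_rpow (by norm_num)]; norm_num
  rw [h3] at h2
  calc binom (p + j - 1) j = 2 ^ j * (binom (p + j - 1) j * (1 / 2) ^ j) := by
        rw [mul_comm, mul_assoc, ← mul_pow]; norm_num
    _ ≤ _ := by gcongr

/-- `p · binom(p + j, j) = (p + j) · binom(p + j - 1, j)`, the upper entries being shifted. -/
theorem mul_choose_succ (p : ℝ) (j : ℕ) :
    p * binom (p + 1 + j - 1) j = (p + j) * binom (p + j - 1) j := by
  have h1 := choose_eq_ascPochhammer (p + 1) j
  have h2 := choose_eq_ascPochhammer p j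
  have h3 : (ascPochhammer ℝ (j + 1)).eval p = p * (ascPochhammer ℝ j).eval (p + 1) := by
    rw [ascPochhammer_succ_left]; simp
  have h4 : (ascPochhammer ℝ (j + 1)).eval p = (ascPochhammer ℝ j).eval p * (p + j) := by
    rw [ascPochhammer_succ_right]; simp
  have hf : (j.factorial : ℝ) ≠ 0 := by positivity
  apply mul_left_cancel₀ hf
  linear_combination p * h1 - (p + j) * h2 - h3 + h4

/-- `(j + 1) binom(p + j, j + 1) = p · binom(p + j, j)`. -/
theorem succ_mul_choose_succ (p : ℝ) (j : ℕ) :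
    (j + 1) * binom (p + (j + 1 : ℕ) - 1) (j + 1) = p * binom (p + 1 + j - 1) j := by
  have h1 := choose_eq_ascPochhammer (p + 1) j
  have h2 := choose_eq_ascPochhammer p (j + 1)
  have h3 : (ascPochhammer ℝ (j + 1)).eval p = p * (ascPochhammer ℝ j).eval (p + 1) := by
    rw [ascPochhammer_succ_left]; simp
  have hf : (j.factorial : ℝ) ≠ 0 := by positivity
  apply mul_left_cancel₀ hf
  rw [Nat.factorial_succ] at h2
  push_cast at h2 ⊢
  linear_combination h2 - p * h1 + h3

/-- Interchange of summation in a series of binomial series. -/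
theorem hasSum_tsum_choose (d q : ℕ → ℝ) (hq : ∀ k, 0 < q k) {s : ℂ} (hs : ‖s‖ < 1)
    (hd : Summable fun k => |d k| * (1 - ‖s‖) ^ (-q k)) :
    HasSum (fun j : ℕ => ((∑' k, d k * binom (q k + j - 1) j : ℝ) : ℂ) * s ^ j)
      (∑' k, (d k : ℂ) * (1 - s) ^ (-(q k : ℂ))) := by
  have hs' : |‖s‖| < 1 := by rwa [abs_norm]
  set F : ℕ × ℕ → ℂ := fun x => (d x.1 : ℂ) * ((binom (q x.1 + x.2 - 1) x.2 : ℝ) * s ^ x.2)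
  have hF : ∀ x, ‖F x‖ = |d x.1| * (binom (q x.1 + x.2 - 1) x.2 * ‖s‖ ^ x.2) := by
    intro x
    simp only [F, norm_mul, norm_pow, Complex.norm_real, Real.norm_eq_abs]
    rw [abs_of_nonneg (choose_nonneg (hq _) _)]
  -- Since the binomial coefficients are nonnegative, the norms along a row again form a binomial
  -- series, at `‖s‖`; this makes `hd` exactly summability over all pairs.
  have hrow : ∀ k, HasSum (fun j => ‖F (k, j)‖) (|d k| * (1 - ‖s‖) ^ (-q k)) := by
    intro k
    simp only [hF]
    exact (hasSum_real_choose_mul_pow (q k) hs').mul_left _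
  have hsum : Summable F := by
    apply Summable.of_norm
    rw [summable_prod_of_nonneg (fun _ => norm_nonneg _)]
    refine ⟨fun k => (hrow k).summable, ?_⟩
    simpa only [fun k => (hrow k).tsum_eq] using hd
  have hrow2 : ∀ k, HasSum (fun j => F (k, j)) ((d k : ℂ) * (1 - s) ^ (-(q k : ℂ))) := by
    intro k
    have := (hasSum_choose_mul_pow (q k : ℂ) hs).mul_left (d k : ℂ)
    have e : (fun j => F (k, j)) =
        fun j : ℕ => (d k : ℂ) * (Ring.choose ((q k : ℂ) + (j : ℕ) - 1) j * s ^ j) := by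
      ext j
      simp only [F]
      rw [Complex.ofReal_choose]
      push_cast
      rfl
    rwa [e]
  have htot := hsum.hasSum.prod_fiberwise hrow2
  have hsw : Summable fun x : ℕ × ℕ => F x.swap := hsum.prod_symm
  have hcol := fun j => (hsw.prod_factor j)
  have h2 := hsw.hasSum.prod_fiberwise (fun j => (hcol j).hasSum)
  rw [htot.tsum_eq]
  have e : ∑' x : ℕ × ℕ, F x.swap = ∑' x, F x := (Equiv.prodComm ℕ ℕ).tsum_eq F
  rw [e] at h2
  convert h2 using 2 with j
  simp only [F, Prod.swap]
  rw [Complex.ofReal_tsum, ← tsum_mul_right]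
  congr 1; ext k; push_cast; ring

/-! ### Power series expansions and resummation of gamma cdfs. -/

/-- Dominated convergence, with majorant `|φ|` times the series at the right endpoint. Only
integrability of `φ` is asked for, so that `ξ^(a-1)` may be singular at zero. -/
theorem hasSum_integral_mul_pow {φ : ℝ → ℝ} {x : ℝ} (hx : 0 ≤ x)
    (hφ : IntervalIntegrable φ volume 0 x) (e : ℕ → ℝ) (he : Summable fun k => |e k| * x ^ k) :
    HasSum (fun k => e k * ∫ ξ in (0 : ℝ)..x, φ ξ * ξ ^ k)
      (∫ ξ in (0 : ℝ)..x, φ ξ * ∑' k, e k * ξ ^ k) := by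
  have key : ∀ k, ∀ t ∈ Set.uIoc 0 x, ‖e k * t ^ k‖ ≤ |e k| * x ^ k := by
    intro k t ht
    rw [Set.uIoc_of_le hx] at ht
    rw [norm_mul, norm_pow, Real.norm_eq_abs, Real.norm_eq_abs, abs_of_pos ht.1]
    have := ht.1.le
    gcongr
    exact ht.2
  have h := intervalIntegral.hasSum_integral_of_dominated_convergence (μ := volume) (a := 0)
    (b := x) (F := fun k t => φ t * (e k * t ^ k)) (f := fun t => φ t * ∑' k, e k * t ^ k)
    (fun k t => |φ t| * (|e k| * x ^ k)) ?_ ?_ ?_ ?_ ?_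
  · refine hasSum_of_eq h (fun k => ?_) rfl
    rw [← intervalIntegral.integral_const_mul]
    congr 1; ext t; ring
  · intro k
    refine AEStronglyMeasurable.mul (intervalIntegrable_iff.1 hφ).aestronglyMeasurable ?_
    exact (by fun_prop : Continuous fun t : ℝ => e k * t ^ k).aestronglyMeasurable
  · intro k
    refine ae_of_all _ fun t ht => ?_
    rw [norm_mul, Real.norm_eq_abs (φ t)]
    gcongr
    exact key k t ht
  · exact ae_of_all _ fun t _ => he.mul_left _
  · simp only [tsum_mul_left]
    exact hφ.abs.mul_const _
  · refine ae_of_all _ fun t ht => ?_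
    exact (Summable.of_norm_bounded he fun k => key k t ht).hasSum.mul_left _

theorem intervalIntegrable_rpow_sub_one {a : ℝ} (ha : 0 < a) (x : ℝ) :
    IntervalIntegrable (fun ξ : ℝ => ξ ^ (a - 1)) volume 0 x :=
  intervalIntegral.intervalIntegrable_rpow' (by linarith)

theorem integral_rpow_mul_pow {a x : ℝ} (ha : 0 < a) (hx : 0 ≤ x) (k : ℕ) :
    ∫ ξ in (0 : ℝ)..x, ξ ^ (a - 1) * ξ ^ k = x ^ (a + k) / (a + k) := by
  have h := integral_rpow (a := 0) (b := x) (r := a + k - 1)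
    (Or.inl (by have := Nat.cast_nonneg (α := ℝ) k; linarith))
  have hk : (0 : ℝ) < a + k := by positivity
  rw [sub_add_cancel, Real.zero_rpow hk.ne', sub_zero] at h
  rw [← h, intervalIntegral.integral_of_le hx, intervalIntegral.integral_of_le hx]
  refine setIntegral_congr_fun measurableSet_Ioc fun ξ hξ => ?_
  rw [← Real.rpow_natCast, ← Real.rpow_add hξ.1]
  ring_nf

theorem summable_abs_alternating (x : ℝ) :
    Summable fun k : ℕ => |(-1 : ℝ) ^ k / k.factorial| * x ^ k := by
  refine (Real.summable_pow_div_factorial x).congr fun k => ?_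
  rw [abs_div, abs_pow, abs_neg, abs_one, one_pow, Nat.abs_cast]
  ring

theorem tsum_alternating (ξ : ℝ) :
    ∑' k : ℕ, (-1 : ℝ) ^ k / k.factorial * ξ ^ k = Real.exp (-ξ) := by
  rw [Real.exp_eq_exp_ℝ, NormedSpace.exp_eq_tsum_div]
  congr 1; ext k
  rw [neg_pow]; ring

theorem hasSum_gammaCdf {a x : ℝ} (ha : 0 < a) (hx : 0 ≤ x) :
    HasSum (fun k : ℕ => (-1) ^ k * x ^ (a + k) / ((a + k) * k.factorial))
      (Real.Gamma a * gammaCdf a x) := by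
  have h := hasSum_integral_mul_pow hx (intervalIntegrable_rpow_sub_one ha x)
    (fun k => (-1 : ℝ) ^ k / k.factorial) (summable_abs_alternating x)
  simp only [integral_rpow_mul_pow ha hx, tsum_alternating] at h
  have hG : Real.Gamma a ≠ 0 := (Real.Gamma_pos_of_pos ha).ne'
  have e : Real.Gamma a * gammaCdf a x = ∫ ξ in (0 : ℝ)..x, ξ ^ (a - 1) * Real.exp (-ξ) := by
    rw [gammaCdf, intervalIntegral.integral_div, mul_div_cancel₀ _ hG]
  refine hasSum_of_eq h (fun k => ?_) e
  have : (a + k : ℝ) ≠ 0 := by positivity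
  field_simp

/-- The rising factorial in `Γ(a + k)` cancels the one in the binomial coefficient. What remains is
the `k`-th term of an exponential type series under a fixed weight. -/
theorem choose_mul_gammaCdf {a x : ℝ} (ha : 0 < a) (hx : 0 ≤ x) (k : ℕ) :
    binom (a + k - 1) k * gammaCdf (a + k) x =
      (Real.Gamma a)⁻¹ * ((k.factorial : ℝ)⁻¹ *
        ∫ ξ in (0 : ℝ)..x, ξ ^ (a - 1) * Real.exp (-ξ) * ξ ^ k) := by
  have hG : ∀ m : ℕ, Real.Gamma (a + m) = (ascPochhammer ℝ m).eval a * Real.Gamma a := by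
    intro m
    induction m with
    | zero => simp
    | succ m ih =>
      have hne : (a + m : ℝ) ≠ 0 := by positivity
      rw [ascPochhammer_succ_right, Nat.cast_succ, ← add_assoc, Real.Gamma_add_one hne, ih]
      simp; ring
  have h1 := choose_eq_ascPochhammer a k
  have h2 := hG k
  rw [← h1] at h2
  have hGa : Real.Gamma a ≠ 0 := (Real.Gamma_pos_of_pos ha).ne'
  have hGk : Real.Gamma (a + k) ≠ 0 := (Real.Gamma_pos_of_pos (by positivity)).ne'
  have hf : (k.factorial : ℝ) ≠ 0 := by positivity
  have hI : ∫ ξ in (0 : ℝ)..x, ξ ^ (a + k - 1) * Real.exp (-ξ) =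
      ∫ ξ in (0 : ℝ)..x, ξ ^ (a - 1) * Real.exp (-ξ) * ξ ^ k := by
    rw [intervalIntegral.integral_of_le hx, intervalIntegral.integral_of_le hx]
    refine setIntegral_congr_fun measurableSet_Ioc fun ξ hξ => ?_
    rw [show a + k - 1 = a - 1 + k by ring, Real.rpow_add hξ.1, Real.rpow_natCast]
    ring
  rw [gammaCdf, intervalIntegral.integral_div, hI]
  field_simp
  rw [h2]
  ring

/-- Resummation of a series of gamma cdfs whose coefficients are alternating differences. -/
theorem hasSum_altDiff_gammaCdf {a x : ℝ} (ha : 0 < a) (hx : 0 ≤ x) (d : ℕ → ℝ)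
    (hd : Summable fun l : ℕ => |d l| * x ^ l / l.factorial) :
    HasSum (fun k : ℕ => (∑ l ∈ Finset.range (k + 1), (-1 : ℝ) ^ l * (k.choose l : ℝ) * d l) *
        binom (a + k - 1) k * gammaCdf (a + k) x)
      ((Real.Gamma a)⁻¹ *
        ∑' l : ℕ, (-1 : ℝ) ^ l * d l * (x ^ (a + l) / ((a + l) * l.factorial))) := by
  set δ : ℕ → ℝ := fun k => ∑ l ∈ Finset.range (k + 1), (-1 : ℝ) ^ l * (k.choose l : ℝ) * d l
  have hf : ∀ ξ : ℝ, 0 ≤ ξ → ξ ≤ x →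
      Summable fun l : ℕ => ‖(-1 : ℝ) ^ l * d l / l.factorial * ξ ^ l‖ := by
    intro ξ h0 h1
    refine Summable.of_nonneg_of_le (fun _ => norm_nonneg _) (fun l => ?_) hd
    rw [norm_mul, norm_div, norm_mul, norm_pow, norm_neg, norm_one, one_pow, one_mul, norm_pow,
      Real.norm_eq_abs, Real.norm_natCast, Real.norm_of_nonneg h0, div_mul_eq_mul_div]
    gcongr
  have hg : ∀ ξ : ℝ, Summable fun l : ℕ => ‖ξ ^ l / l.factorial‖ := fun ξ =>
    (Real.summable_pow_div_factorial ξ).norm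
  -- The alternating differences are a binomial transform: `∑ δ_k ξ^k / k!` is the Cauchy product of
  -- `∑ (-1)^l d_l ξ^l / l!` with the series of `exp ξ`.
  have hterm : ∀ (ξ : ℝ) (k : ℕ), ∑ l ∈ Finset.range (k + 1),
      ((-1 : ℝ) ^ l * d l / l.factorial * ξ ^ l) * (ξ ^ (k - l) / (k - l).factorial) =
      δ k / k.factorial * ξ ^ k := by
    intro ξ k
    simp only [δ, Finset.sum_div, Finset.sum_mul]
    refine Finset.sum_congr rfl fun l hl => ?_
    have hlk : l ≤ k := Nat.lt_succ_iff.1 (Finset.mem_range.1 hl)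
    have h1 : ((k.choose l : ℕ) : ℝ) = k.factorial / (l.factorial * (k - l).factorial) := by
      rw [eq_div_iff (by positivity)]
      have := Nat.choose_mul_factorial_mul_factorial hlk
      rw [← mul_assoc]
      exact_mod_cast this
    rw [h1, show ξ ^ k = ξ ^ l * ξ ^ (k - l) by rw [← pow_add, Nat.add_sub_cancel' hlk]]
    field_simp
  have hprod : ∀ ξ : ℝ, 0 ≤ ξ → ξ ≤ x → ∑' k, δ k / k.factorial * ξ ^ k =
      (∑' l : ℕ, (-1 : ℝ) ^ l * d l / l.factorial * ξ ^ l) * Real.exp ξ := by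
    intro ξ h0 h1
    rw [Real.exp_eq_exp_ℝ, NormedSpace.exp_eq_tsum_div,
      tsum_mul_tsum_eq_tsum_sum_range_of_summable_norm (hf ξ h0 h1) (hg ξ)]
    simp only [hterm]
  have hsδ : Summable fun k : ℕ => |δ k / k.factorial| * x ^ k := by
    have := summable_norm_sum_mul_range_of_summable_norm (hf x hx le_rfl) (hg x)
    refine this.congr fun k => ?_
    rw [hterm, norm_mul, Real.norm_eq_abs, Real.norm_of_nonneg (by positivity)]
  have hφ := intervalIntegrable_rpow_sub_one ha x
  have h1 := hasSum_integral_mul_pow hx (hφ.mul_continuousOn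
    (g := fun ξ => Real.exp (-ξ)) (by fun_prop)) _ hsδ
  have h2 := hasSum_integral_mul_pow hx hφ (fun l => (-1 : ℝ) ^ l * d l / l.factorial) (by
    refine hd.congr fun l => ?_
    rw [abs_div, abs_mul, abs_pow, abs_neg, abs_one, one_pow, Nat.abs_cast]
    ring)
  -- The factor `exp ξ` of the Cauchy product cancels the weight `exp (-ξ)` of the gamma densities.
  have e : ∫ ξ in (0 : ℝ)..x, ξ ^ (a - 1) * Real.exp (-ξ) * ∑' k, δ k / k.factorial * ξ ^ k =
      ∫ ξ in (0 : ℝ)..x, ξ ^ (a - 1) * ∑' l : ℕ, (-1 : ℝ) ^ l * d l / l.factorial * ξ ^ l := by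
    rw [intervalIntegral.integral_of_le hx, intervalIntegral.integral_of_le hx]
    refine setIntegral_congr_fun measurableSet_Ioc fun ξ hξ => ?_
    rw [hprod ξ hξ.1.le hξ.2, Real.exp_neg]
    field_simp
  rw [e, ← h2.tsum_eq] at h1
  simp only [integral_rpow_mul_pow ha hx] at h1
  have h3 := h1.mul_left (Real.Gamma a)⁻¹
  refine hasSum_of_eq h3 (fun k => ?_) ?_
  · rw [mul_assoc, choose_mul_gammaCdf ha hx]
    ring
  · congr 2; ext l
    have : (a + l : ℝ) ≠ 0 := by positivity
    field_simp

/-! ### Expansion in powers of `w` and a uniform bound for its coefficients. -/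

/-- The coefficients of the expansion of `Γ(a) G_a(x / √(1 - w))` in powers of `w`. -/
def innerSeries (a : ℝ) (j : ℕ) (x : ℝ) : ℝ :=
  ∑' k : ℕ, (-1) ^ k * x ^ (a + k) / ((a + k) * k.factorial) * binom ((a + k) / 2 + j - 1) j

/-- Each power `(x / √(1 - w))^(a + k)` contributes a binomial series in `w`. As `w ≥ 0`, the
absolute double series is controlled by the absolutely convergent series of `gammaCdf` at `x / √(1 -
w)`. -/
theorem hasSum_innerSeries {a x w : ℝ} (ha : 0 < a) (hx : 0 ≤ x) (hw0 : 0 ≤ w) (hw : w < 1) :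
    HasSum (fun j => innerSeries a j x * w ^ j) (Real.Gamma a * gammaCdf a (x / √(1 - w))) := by
  have hw1 : 0 < 1 - w := by linarith
  have hG := hasSum_gammaCdf ha (x := x / √(1 - w)) (by positivity)
  have hpow : ∀ k : ℕ, (x / √(1 - w)) ^ (a + k) = x ^ (a + k) * (1 - w) ^ (-((a + k) / 2)) := by
    intro k
    rw [Real.div_rpow hx (Real.sqrt_nonneg _), Real.sqrt_eq_rpow, ← Real.rpow_mul hw1.le,
      Real.rpow_neg hw1.le, div_eq_mul_inv]
    ring_nf
  have hnorm : ‖(w : ℂ)‖ = w := by rw [Complex.norm_real, Real.norm_of_nonneg hw0]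
  have h := hasSum_tsum_choose (fun k : ℕ => (-1) ^ k * x ^ (a + k) / ((a + k) * k.factorial))
    (fun k => (a + k) / 2) (fun k => by positivity) (s := w) (by rwa [hnorm]) (by
      refine hG.summable.abs.congr fun k => ?_
      rw [hpow, hnorm, ← mul_assoc, mul_div_right_comm, abs_mul,
        abs_of_pos (a := (1 - w) ^ (-((a + k) / 2))) (by positivity)])
  have e : ∑' k : ℕ, (((-1) ^ k * x ^ (a + k) / ((a + k) * k.factorial) : ℝ) : ℂ) *
      (1 - (w : ℂ)) ^ (-(((a + k) / 2 : ℝ) : ℂ)) = ((Real.Gamma a * gammaCdf a (x / √(1 - w)) : ℝ) : ℂ) := by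
    rw [← hG.tsum_eq, Complex.ofReal_tsum]
    congr 1; ext k
    rw [hpow, ← mul_assoc, mul_div_right_comm _ ((1 - w) ^ _), Complex.ofReal_mul, Complex.ofReal_cpow hw1.le]
    push_cast
    rfl
  refine Complex.hasSum_ofReal.1 (hasSum_of_eq h (fun j => ?_) e.symm)
  simp only [innerSeries]
  push_cast
  rfl

theorem innerSeries_zero_right {a : ℝ} (ha : 0 < a) (j : ℕ) : innerSeries a j 0 = 0 := by
  rw [innerSeries]
  convert tsum_zero with k
  rw [Real.zero_rpow (by positivity)]
  simp

/-- The generating function of `(j + 1) * innerSeries a (j + 1) x`. -/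
def innerGen (a x : ℝ) (s : ℂ) : ℂ :=
  ((x ^ a / 2 : ℝ) : ℂ) * (1 - s) ^ (-((a / 2 + 1 : ℝ) : ℂ)) *
    Complex.exp (-x * (1 - s) ^ (-(1 / 2) : ℂ))

theorem one_sub_mem_slitPlane {s : ℂ} (hs : ‖s‖ < 1) : 1 - s ∈ Complex.slitPlane := by
  have := Complex.mem_slitPlane_of_norm_lt_one (z := -s) (by simpa using hs)
  rwa [← sub_eq_add_neg] at this

theorem differentiableAt_innerGen (a x : ℝ) {s : ℂ} (hs : ‖s‖ < 1) :
    DifferentiableAt ℂ (innerGen a x) s := by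
  have h := one_sub_mem_slitPlane hs
  have h1 : ∀ c : ℂ, DifferentiableAt ℂ (fun s : ℂ => (1 - s) ^ c) s := fun c =>
    DifferentiableAt.cpow_const (by fun_prop) h
  unfold innerGen
  exact ((differentiableAt_const _).mul (h1 _)).mul ((h1 _).const_mul _).cexp

/-- This is the `w`-derivative of the expansion. Differentiation produces the factor `(a + k)/2`,
which removes the denominator `a + k`, so the sum over `k` closes up to an exponential. -/
theorem hasSum_innerGen {a x : ℝ} (ha : 0 < a) (hx : 0 < x) {s : ℂ} (hs : ‖s‖ < 1) :
    HasSum (fun j : ℕ => (((j + 1) * innerSeries a (j + 1) x : ℝ) : ℂ) * s ^ j)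
      (innerGen a x s) := by
  have hs1 : 0 < 1 - ‖s‖ := by linarith
  have h := hasSum_tsum_choose (fun k : ℕ => (-1) ^ k * x ^ (a + k) / (2 * k.factorial))
    (fun k => (a + k) / 2 + 1) (fun k => by positivity) hs (by
      have := (Real.summable_pow_div_factorial (x * (1 - ‖s‖) ^ (-(1 / 2) : ℝ))).mul_left
        (x ^ a / 2 * (1 - ‖s‖) ^ (-(a / 2 + 1)))
      refine this.congr fun k => ?_
      rw [abs_div, abs_mul, abs_pow, abs_neg, abs_one, one_pow, one_mul,
        abs_of_pos (by positivity), abs_of_pos (by positivity : (0 : ℝ) < 2 * k.factorial),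
        Real.rpow_add hx, Real.rpow_natCast, mul_pow, ← Real.rpow_mul_natCast hs1.le,
        show -((a + k) / 2 + 1) = -(a / 2 + 1) + -(1 / 2) * (k : ℝ) by ring, Real.rpow_add hs1]
      field_simp)
  refine hasSum_of_eq h (fun j => ?_) ?_
  · congr 2
    rw [innerSeries, ← tsum_mul_left]
    congr 1; ext k
    have h1 := succ_mul_choose_succ ((a + k) / 2) j
    have : (a + k : ℝ) ≠ 0 := by positivity
    calc _ = (-1) ^ k * x ^ (a + k) / ((a + k) * k.factorial) *
          ((j + 1) * binom ((a + k) / 2 + (j + 1 : ℕ) - 1) (j + 1)) := by ring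
      _ = _ := by rw [h1]; field_simp
  · have hne : 1 - s ≠ 0 := Complex.slitPlane_ne_zero (one_sub_mem_slitPlane hs)
    rw [innerGen, Complex.exp_eq_exp_ℂ, NormedSpace.exp_eq_tsum_div, ← tsum_mul_left]
    congr 1; ext k
    rw [show (-(((a + k) / 2 + 1 : ℝ) : ℂ)) = -((a / 2 + 1 : ℝ) : ℂ) + -(1 / 2) * (k : ℂ) by
      push_cast; ring, Complex.cpow_add _ _ hne, Complex.cpow_mul_nat, mul_pow, neg_pow,
      Real.rpow_add hx, Real.rpow_natCast]
    push_cast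
    field_simp

theorem exists_rpow_mul_exp_le (b : ℝ) (hb : 0 ≤ b) :
    ∃ K : ℝ, 0 < K ∧ ∀ u : ℝ, 0 ≤ u → (1 + u ^ 2) ^ b * Real.exp (-(u / 2)) ≤ K := by
  obtain ⟨N, hN⟩ := exists_nat_ge (2 * b)
  -- For an integer `N ≥ 2b`, `(1 + u²)^b ≤ (1 + u)^N ≤ N! 2^N exp((1 + u)/2)`, by one term of the
  -- exponential series.
  refine ⟨N.factorial * 2 ^ N * Real.exp (1 / 2), by positivity, fun u hu => ?_⟩
  have h1 : (1 + u ^ 2) ^ b ≤ (1 + u) ^ N := by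
    calc (1 + u ^ 2) ^ b ≤ ((1 + u) ^ (2 : ℝ)) ^ b := by
          gcongr
          rw [Real.rpow_ofNat]
          nlinarith
      _ = (1 + u) ^ (2 * b) := by rw [← Real.rpow_mul (by positivity)]
      _ ≤ (1 + u) ^ (N : ℝ) := Real.rpow_le_rpow_of_exponent_le (by linarith) hN
      _ = _ := Real.rpow_natCast _ _
  have h2 := Real.pow_div_factorial_le_exp ((1 + u) / 2) (by positivity) N
  rw [div_le_iff₀ (by positivity), div_pow, div_le_iff₀ (by positivity)] at h2
  calc _ ≤ (Real.exp ((1 + u) / 2) * N.factorial * 2 ^ N) * Real.exp (-(u / 2)) := by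
        gcongr
        exact h1.trans h2
    _ = N.factorial * 2 ^ N * (Real.exp ((1 + u) / 2) * Real.exp (-(u / 2))) := by ring
    _ = _ := by rw [← Real.exp_add]; ring_nf

/-- On the unit disc `1 - s` has positive real part, so its inverse square root stays in the sector
of half-angle `π/4` and the exponential really decays. This decay absorbs the singularity at `s = 1`
on the scale `|1 - s| ~ x²`. -/
theorem norm_innerGen_le {a x K : ℝ} (hx : 0 < x)
    (hK : ∀ u : ℝ, 0 ≤ u → (1 + u ^ 2) ^ (a / 2 + 1) * Real.exp (-(u / 2)) ≤ K)
    {s : ℂ} (hs : ‖s‖ < 1) :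
    ‖innerGen a x s‖ ≤ K * x ^ a * (x ^ 2 + ‖1 - s‖) ^ (-(a / 2 + 1)) := by
  have hsl := one_sub_mem_slitPlane hs
  have hne : 1 - s ≠ 0 := Complex.slitPlane_ne_zero hsl
  have hre : 0 < (1 - s).re := by
    have := Complex.re_le_norm s
    simp only [Complex.sub_re, Complex.one_re]; linarith
  set z := 1 - s with hz
  set ρ := ‖z‖ with hρ
  have hρ0 : 0 < ρ := norm_pos_iff.2 hne
  have harg : |z.arg| ≤ Real.pi / 2 := Complex.abs_arg_le_pi_div_two_iff.2 hre.le
  have hroot : ρ ^ (-(1 / 2) : ℝ) / 2 ≤ (z ^ (-(1 / 2) : ℂ)).re := by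
    have e : z ^ (-(1 / 2) : ℂ) = Complex.exp (Complex.log z * ((-(1 / 2) : ℝ) : ℂ)) := by
      rw [Complex.cpow_def_of_ne_zero hne]; push_cast; rfl
    rw [e, Complex.exp_re, Complex.re_mul_ofReal, Complex.im_mul_ofReal, Complex.log_re,
      Complex.log_im, ← Real.rpow_def_of_pos hρ0]
    -- Half the argument is at most `π/4`, hence below `π/3`, where the cosine takes the convenient
    -- value `1/2`.
    have hc : Real.cos (Real.pi / 3) ≤ Real.cos (z.arg * -(1 / 2)) := by
      rw [← Real.cos_abs (z.arg * _), abs_mul]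
      apply Real.cos_le_cos_of_nonneg_of_le_pi (by positivity) (by linarith [Real.pi_pos])
      rw [abs_neg, abs_of_pos (by norm_num : (0 : ℝ) < 1 / 2)]
      linarith [Real.pi_pos]
    rw [Real.cos_pi_div_three] at hc
    have : 0 < ρ ^ (-(1 / 2) : ℝ) := by positivity
    nlinarith
  set u := x * ρ ^ (-(1 / 2) : ℝ) with hu
  have hu0 : 0 ≤ u := by positivity
  have hexp : ‖Complex.exp (-x * z ^ (-(1 / 2) : ℂ))‖ ≤ Real.exp (-(u / 2)) := by
    rw [Complex.norm_exp, Real.exp_le_exp, ← Complex.ofReal_neg, Complex.re_ofReal_mul]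
    nlinarith
  have hu2 : x ^ 2 + ρ = ρ * (1 + u ^ 2) := by
    rw [hu, mul_pow, ← Real.rpow_mul_natCast hρ0.le]
    norm_num
    rw [Real.rpow_neg_one]
    field_simp
    ring
  have hpw : ‖z ^ (-((a / 2 + 1 : ℝ) : ℂ))‖ = ρ ^ (-(a / 2 + 1)) := by
    rw [← Complex.ofReal_neg]
    exact Complex.norm_cpow_real _ _
  have hb := hK u hu0
  rw [innerGen, norm_mul, norm_mul, Complex.norm_real, Real.norm_of_nonneg (by positivity), ← hz,
    hpw, hu2, Real.mul_rpow hρ0.le (by positivity)]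
  have h1 : Real.exp (-(u / 2)) ≤ K * (1 + u ^ 2) ^ (-(a / 2 + 1)) := by
    rw [Real.rpow_neg (by positivity), ← div_eq_mul_inv, le_div_iff₀ (by positivity), mul_comm]
    exact hb
  calc x ^ a / 2 * ρ ^ (-(a / 2 + 1)) * ‖Complex.exp (-x * z ^ (-(1 / 2) : ℂ))‖
      ≤ x ^ a * ρ ^ (-(a / 2 + 1)) * (K * (1 + u ^ 2) ^ (-(a / 2 + 1))) := by
        gcongr
        · have : 0 ≤ x ^ a := by positivity
          linarith
        · exact hexp.trans h1
    _ = _ := by ring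

/-- The squared distance is `(1 - R)² + 2R(1 - cos θ)`; use `2R ≥ 1` and `1 - cos θ ≥ 2θ²/π²`. -/
theorem abs_div_pi_le_norm_one_sub_circleMap {R θ : ℝ} (hR : 1 / 2 ≤ R) (hθ : |θ| ≤ Real.pi) :
    |θ| / Real.pi ≤ ‖1 - circleMap 0 R θ‖ := by
  have hc := Real.cos_le_one_sub_mul_cos_sq hθ
  have hn : ‖1 - circleMap 0 R θ‖ ^ 2 = (1 - R) ^ 2 + 2 * R * (1 - Real.cos θ) := by
    rw [← Complex.normSq_eq_norm_sq, Complex.normSq_apply]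
    simp only [circleMap, zero_add, Complex.sub_re, Complex.sub_im, Complex.one_re, Complex.one_im,
      Complex.re_ofReal_mul, Complex.im_ofReal_mul, Complex.exp_ofReal_mul_I_re,
      Complex.exp_ofReal_mul_I_im]
    nlinarith [Real.sin_sq_add_cos_sq θ]
  apply le_of_sq_le_sq _ (norm_nonneg _)
  rw [hn, div_pow, sq_abs]
  have h2 : θ ^ 2 / Real.pi ^ 2 ≤ 1 - Real.cos θ := by
    have : 0 ≤ θ ^ 2 / Real.pi ^ 2 := by positivity
    have e : 2 / Real.pi ^ 2 * θ ^ 2 = 2 * (θ ^ 2 / Real.pi ^ 2) := by ring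
    linarith
  have h3 := Real.cos_le_one θ
  nlinarith [sq_nonneg (1 - R)]

theorem integral_rpow_neg_le {y β : ℝ} (hy : 0 < y) (hβ : 0 < β) :
    ∫ θ in (0 : ℝ)..Real.pi, (y + θ / Real.pi) ^ (-(β + 1)) ≤ Real.pi / β * y ^ (-β) := by
  have hpi := Real.pi_pos
  have hder : ∀ θ ∈ Set.uIcc 0 Real.pi, HasDerivAt
      (fun θ => -(Real.pi / β) * (y + θ / Real.pi) ^ (-β)) ((y + θ / Real.pi) ^ (-(β + 1))) θ := by
    intro θ hθ
    rw [Set.uIcc_of_le hpi.le] at hθ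
    have hpos : 0 < y + θ / Real.pi := add_pos_of_pos_of_nonneg hy (div_nonneg hθ.1 hpi.le)
    have h1 : HasDerivAt (fun θ => y + θ / Real.pi) (1 / Real.pi) θ :=
      ((hasDerivAt_id θ).div_const _).const_add y
    have h2 := (h1.rpow_const (p := -β) (Or.inl hpos.ne')).const_mul (-(Real.pi / β))
    have e : -(Real.pi / β) * (1 / Real.pi * -β * (y + θ / Real.pi) ^ (-β - 1)) =
        (y + θ / Real.pi) ^ (-(β + 1)) := by
      rw [show -β - 1 = -(β + 1) by ring]
      field_simp
    rwa [e] at h2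
  rw [intervalIntegral.integral_eq_sub_of_hasDerivAt hder]
  · have : 0 ≤ Real.pi / β * (y + Real.pi / Real.pi) ^ (-β) := by positivity
    simp only [zero_div, add_zero]
    linarith
  · apply ContinuousOn.intervalIntegrable
    rw [Set.uIcc_of_le hpi.le]
    intro θ hθ
    have hpos : 0 < y + θ / Real.pi := add_pos_of_pos_of_nonneg hy (div_nonneg hθ.1 hpi.le)
    exact (ContinuousAt.rpow_const (f := fun θ => y + θ / Real.pi) (by fun_prop)
      (Or.inl hpos.ne')).continuousWithinAt

/-- The mean over the circle is needed: the pointwise bound is only of order `x^(-2)` near `s = 1`.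
Integrating it in the angle gives a multiple of `(x²)^(-a/2) = x^(-a)`, which cancels the prefactor
`x^a` and leaves a bound free of `x` and `R`. -/
theorem integral_norm_innerGen_le {a x K R : ℝ} (ha : 0 < a) (hx : 0 < x) (hK0 : 0 < K)
    (hK : ∀ u : ℝ, 0 ≤ u → (1 + u ^ 2) ^ (a / 2 + 1) * Real.exp (-(u / 2)) ≤ K)
    (hR : 1 / 2 ≤ R) (hR1 : R < 1) :
    ∫ θ in (0 : ℝ)..2 * Real.pi, ‖innerGen a x (circleMap 0 R θ)‖ ≤ 4 * Real.pi * K / a := by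
  have hpi := Real.pi_pos
  set f : ℝ → ℝ := fun θ => ‖innerGen a x (circleMap 0 R θ)‖ with hf
  have hnorm : ∀ θ, ‖circleMap 0 R θ‖ < 1 := fun θ => by
    rw [norm_circleMap_zero, abs_of_pos (by linarith)]; exact hR1
  have hcont : Continuous f := by
    refine Continuous.norm (continuous_iff_continuousAt.2 fun θ => ?_)
    exact ContinuousAt.comp (f := circleMap 0 R)
      (differentiableAt_innerGen a x (hnorm θ)).continuousAt
      (continuous_circleMap 0 R).continuousAt
  have hper : Function.Periodic f (2 * Real.pi) := fun θ => by
    simp only [hf, periodic_circleMap 0 R θ]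
  have h1 : ∫ θ in (0 : ℝ)..2 * Real.pi, f θ = ∫ θ in -Real.pi..Real.pi, f θ := by
    have := hper.intervalIntegral_add_eq 0 (-Real.pi)
    rw [zero_add] at this
    rw [this]; congr 1; ring
  have h2 : ∫ θ in -Real.pi..0, f θ = ∫ θ in (0 : ℝ)..Real.pi, f (-θ) := by
    rw [intervalIntegral.integral_comp_neg, neg_zero]
  rw [h1, ← intervalIntegral.integral_add_adjacent_intervals (b := 0)
    (hcont.intervalIntegrable _ _) (hcont.intervalIntegrable _ _), h2]
  have hbd : ∀ θ, |θ| ≤ Real.pi →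
      f θ ≤ K * x ^ a * (x ^ 2 + |θ| / Real.pi) ^ (-(a / 2 + 1)) := by
    intro θ hθ
    refine (norm_innerGen_le hx hK (hnorm θ)).trans ?_
    refine mul_le_mul_of_nonneg_left ?_ (by positivity)
    apply Real.rpow_le_rpow_of_nonpos (by positivity)
    · linarith [abs_div_pi_le_norm_one_sub_circleMap hR hθ]
    · linarith
  have hint : IntervalIntegrable
      (fun θ => K * x ^ a * (x ^ 2 + θ / Real.pi) ^ (-(a / 2 + 1))) volume 0 Real.pi := by
    apply ContinuousOn.intervalIntegrable
    rw [Set.uIcc_of_le hpi.le]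
    intro θ hθ
    have hpos : 0 < x ^ 2 + θ / Real.pi :=
      add_pos_of_pos_of_nonneg (by positivity) (div_nonneg hθ.1 hpi.le)
    exact (ContinuousAt.const_mul (ContinuousAt.rpow_const (f := fun θ => x ^ 2 + θ / Real.pi)
      (by fun_prop) (Or.inl hpos.ne')) _
      ).continuousWithinAt
  have hI := integral_rpow_neg_le (y := x ^ 2) (β := a / 2) (by positivity) (by positivity)
  have hx2 : (x ^ 2) ^ (-(a / 2)) = (x ^ a)⁻¹ := by
    rw [← Real.rpow_natCast, ← Real.rpow_mul hx.le, ← Real.rpow_neg hx.le]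
    congr 1; push_cast; ring
  have hhalf : ∀ g : ℝ → ℝ, Continuous g → (∀ θ ∈ Set.Icc 0 Real.pi,
      g θ ≤ K * x ^ a * (x ^ 2 + θ / Real.pi) ^ (-(a / 2 + 1))) →
      ∫ θ in (0 : ℝ)..Real.pi, g θ ≤ 2 * Real.pi * K / a := by
    intro g hg hle
    calc _ ≤ ∫ θ in (0 : ℝ)..Real.pi, K * x ^ a * (x ^ 2 + θ / Real.pi) ^ (-(a / 2 + 1)) :=
          intervalIntegral.integral_mono_on hpi.le (hg.intervalIntegrable _ _) hint hle
      _ = K * x ^ a * ∫ θ in (0 : ℝ)..Real.pi, (x ^ 2 + θ / Real.pi) ^ (-(a / 2 + 1)) :=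
          intervalIntegral.integral_const_mul _ _
      _ ≤ K * x ^ a * (Real.pi / (a / 2) * (x ^ 2) ^ (-(a / 2))) := by gcongr
      _ = _ := by
          rw [hx2]
          have : x ^ a ≠ 0 := by positivity
          field_simp
  have hA := hhalf (fun θ => f (-θ)) (by fun_prop) (fun θ hθ => by
    have := hbd (-θ) (by rw [abs_neg, abs_of_nonneg hθ.1]; exact hθ.2)
    rwa [abs_neg, abs_of_nonneg hθ.1] at this)
  have hB := hhalf f hcont (fun θ hθ => by
    have := hbd θ (by rw [abs_of_nonneg hθ.1]; exact hθ.2)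
    rwa [abs_of_nonneg hθ.1] at this)
  calc _ ≤ 2 * Real.pi * K / a + 2 * Real.pi * K / a := add_le_add hA hB
    _ = _ := by ring

/-- Cauchy's coefficient estimate applied to the derivative: its coefficient of index `j - 1` is `j`
times the wanted one, and this is the source of the factor `1/j`. -/
theorem exists_abs_innerSeries_le {a : ℝ} (ha : 0 < a) :
    ∃ C : ℝ, 0 < C ∧ ∀ j : ℕ, 1 ≤ j → ∀ x : ℝ, 0 ≤ x → |innerSeries a j x| ≤ C / j := by
  obtain ⟨K, hK0, hK⟩ := exists_rpow_mul_exp_le (a / 2 + 1) (by positivity)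
  refine ⟨2 * K / a, by positivity, fun j hj x hx => ?_⟩
  rcases hx.eq_or_lt with rfl | hx
  · rw [innerSeries_zero_right ha, abs_zero]; positivity
  obtain ⟨m, rfl⟩ : ∃ m, j = m + 1 := ⟨j - 1, by omega⟩
  have hpi := Real.pi_pos
  set p : FormalMultilinearSeries ℂ ℂ ℂ :=
    .ofScalars ℂ fun j : ℕ => (((j + 1) * innerSeries a (j + 1) x : ℝ) : ℂ) with hp
  have hser : HasFPowerSeriesAt (innerGen a x) p 0 := by
    rw [hasFPowerSeriesAt_iff]
    filter_upwards [Metric.ball_mem_nhds (0 : ℂ) one_pos] with s hs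
    rw [mem_ball_zero_iff] at hs
    refine hasSum_of_eq (hasSum_innerGen ha hx hs) (fun j => ?_) (by rw [zero_add])
    rw [hp, FormalMultilinearSeries.coeff_ofScalars, smul_eq_mul, mul_comm]
  have hR : ∀ R : ℝ, 1 / 2 ≤ R → R < 1 →
      R ^ m * |(m + 1) * innerSeries a (m + 1) x| ≤ 2 * K / a := by
    intro R hR hR1
    have hR0 : 0 < R := by linarith
    lift R to NNReal using hR0.le
    have hc := (DifferentiableOn.hasFPowerSeriesOnBall (f := innerGen a x) (c := 0) (R := R)
      (fun s hs => (differentiableAt_innerGen a x (by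
        rw [mem_closedBall_zero_iff] at hs
        exact hs.trans_lt hR1)).differentiableWithinAt) (by exact_mod_cast hR0))
    have he := hser.eq_formalMultilinearSeries hc.hasFPowerSeriesAt
    have hn := norm_cauchyPowerSeries_le (innerGen a x) 0 R m
    rw [← he, FormalMultilinearSeries.norm_apply_eq_norm_coef, hp,
      FormalMultilinearSeries.coeff_ofScalars, Complex.norm_real, Real.norm_eq_abs,
      abs_of_pos hR0] at hn
    have hI := integral_norm_innerGen_le ha hx hK0 hK hR hR1
    calc _ ≤ (R : ℝ) ^ m * (((2 * Real.pi)⁻¹ * (4 * Real.pi * K / a)) * (R : ℝ)⁻¹ ^ m) := by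
          gcongr
          refine hn.trans ?_
          gcongr
      _ = _ := by
          rw [inv_pow]
          field_simp
          norm_num
  -- The bound does not depend on `R`, so letting `R` tend to `1` removes the factor `R ^ m`.
  have hlim : Tendsto (fun R : ℝ => R ^ m * |(m + 1) * innerSeries a (m + 1) x|) (𝓝[<] 1)
      (𝓝 (1 ^ m * |(m + 1) * innerSeries a (m + 1) x|)) :=
    ((by fun_prop : Continuous fun R : ℝ => R ^ m * |(m + 1) * innerSeries a (m + 1) x|).tendsto
      1).mono_left nhdsWithin_le_nhds
  have hfin := le_of_tendsto hlim (by
    filter_upwards [Ico_mem_nhdsLT (by norm_num : (1 / 2 : ℝ) < 1)] with R hR'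
    exact hR R hR'.1 hR'.2)
  rw [one_pow, one_mul, abs_mul, abs_of_pos (by positivity : (0 : ℝ) < m + 1)] at hfin
  rw [le_div_iff₀ (by positivity)]
  push_cast
  linarith

theorem summable_choose_mul_pow {a R : ℝ} (ha : 0 < a) (hR : 0 ≤ R) (j : ℕ) :
    Summable fun k : ℕ => binom ((a + k) / 2 + j - 1) j * R ^ k / k.factorial := by
  have h := (Real.summable_pow_div_factorial (2 ^ (1 / 2 : ℝ) * R)).mul_left (2 ^ (j + a / 2 : ℝ))
  refine Summable.of_nonneg_of_le (fun k => ?_) (fun k => ?_) h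
  · have := choose_nonneg (p := (a + k) / 2) (by positivity) j
    positivity
  · have := choose_le (p := (a + k) / 2) (by positivity) j
    rw [mul_pow, ← Real.rpow_mul_natCast (by norm_num), mul_div_assoc, mul_div_assoc, ← mul_assoc,
      ← Real.rpow_add (by norm_num)]
    refine mul_le_mul_of_nonneg_right (this.trans_eq ?_) (by positivity)
    congr 1; ring

/-! ### Power series with a fractional exponent -/

/-- The generalized power series `∑ c_k z^(q + k/2)`. -/
def halfSeries (c : ℕ → ℝ) (q : ℝ) (z : ℝ) : ℝ :=
  ∑' k : ℕ, c k * z ^ (q + k / 2)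

/-- Differentiation multiplies the coefficients by a linear factor in `k`; it is absorbed by `2^k`,
that is, by passing from `R` to `2R`. -/
theorem summable_mul_linear {c : ℕ → ℝ} (hc : ∀ R : ℝ, 0 < R → Summable fun k => |c k| * R ^ k)
    (q : ℝ) {R : ℝ} (hR : 0 < R) : Summable fun k => |c k * (q + k / 2)| * R ^ k := by
  refine Summable.of_nonneg_of_le (fun k => by positivity) (fun k => ?_)
    ((hc (2 * R) (by positivity)).mul_left (|q| + 1))
  have h2 : (k : ℝ) ≤ 2 ^ k := by exact_mod_cast Nat.lt_two_pow_self.le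
  have h1 : (1 : ℝ) ≤ 2 ^ k := one_le_pow₀ (by norm_num)
  have h : |q + k / 2| ≤ (|q| + 1) * 2 ^ k := by
    calc |q + k / 2| ≤ |q| + |(k : ℝ) / 2| := abs_add_le _ _
      _ = |q| + k / 2 := by rw [abs_of_nonneg (by positivity : (0 : ℝ) ≤ k / 2)]
      _ ≤ _ := by nlinarith [abs_nonneg q]
  rw [abs_mul, mul_pow]
  calc |c k| * |q + k / 2| * R ^ k ≤ |c k| * ((|q| + 1) * 2 ^ k) * R ^ k := by gcongr
    _ = _ := by ring

theorem rpow_half_mul {z : ℝ} (hz : 0 < z) (q : ℝ) (k : ℕ) :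
    z ^ (q + k / 2) = z ^ q * √z ^ k := by
  rw [Real.rpow_add hz, Real.sqrt_eq_rpow, ← Real.rpow_mul_natCast hz.le]
  congr 2; ring

theorem hasDerivAt_halfSeries {c : ℕ → ℝ} (hc : ∀ R : ℝ, 0 < R → Summable fun k => |c k| * R ^ k)
    (q : ℝ) {z : ℝ} (hz : 0 < z) :
    HasDerivAt (halfSeries c q) (halfSeries (fun k => c k * (q + k / 2)) (q - 1) z) z := by
  have hsum := summable_mul_linear hc q (R := √(2 * z)) (by positivity)
  refine hasDerivAt_tsum_of_isPreconnected (t := Set.Ioo (z / 2) (2 * z)) (y₀ := z)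
    (g := fun k z => c k * z ^ (q + k / 2))
    (g' := fun k z => c k * (q + k / 2) * z ^ (q - 1 + k / 2))
    -- The sum of the two endpoint powers bounds `y^(q-1)` on the interval whatever the sign of `q -
    -- 1`.
    (u := fun k => ((z / 2) ^ (q - 1) + (2 * z) ^ (q - 1)) *
      (|c k * (q + k / 2)| * √(2 * z) ^ k)) (hsum.mul_left _) isOpen_Ioo isPreconnected_Ioo
    (fun k y hy => ?_) (fun k y hy => ?_) ⟨by linarith, by linarith⟩ ?_
    ⟨by linarith, by linarith⟩
  · have hy0 : 0 < y := lt_trans (by positivity) hy.1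
    have := (Real.hasDerivAt_rpow_const (x := y) (p := q + k / 2) (Or.inl hy0.ne')).const_mul (c k)
    rw [← mul_assoc] at this
    rwa [show q - 1 + (k : ℝ) / 2 = q + k / 2 - 1 by ring]
  · have hy0 : 0 < y := lt_trans (by positivity) hy.1
    rw [rpow_half_mul hy0, norm_mul, Real.norm_eq_abs,
      Real.norm_of_nonneg (by positivity : (0 : ℝ) ≤ y ^ (q - 1) * √y ^ k), mul_left_comm]
    have h1 : y ^ (q - 1) ≤ (z / 2) ^ (q - 1) + (2 * z) ^ (q - 1) := by
      have e1 : 0 < (z / 2) ^ (q - 1) := by positivity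
      have e2 : 0 < (2 * z) ^ (q - 1) := by positivity
      rcases le_total 0 (q - 1) with h | h
      · have := Real.rpow_le_rpow hy0.le hy.2.le h
        linarith
      · have := Real.rpow_le_rpow_of_nonpos (by positivity) hy.1.le h
        linarith
    have h2 : √y ≤ √(2 * z) := Real.sqrt_le_sqrt hy.2.le
    gcongr
  · refine Summable.of_norm_bounded ((hc (√z) (by positivity)).mul_left (z ^ q)) fun k => ?_
    rw [rpow_half_mul hz, norm_mul, Real.norm_eq_abs, Real.norm_of_nonneg (by positivity)]
    exact (by ring : |c k| * (z ^ q * √z ^ k) = z ^ q * (|c k| * √z ^ k)).le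

theorem contDiffOn_halfSeries (d : ℕ) : ∀ {c : ℕ → ℝ}
    (_ : ∀ R : ℝ, 0 < R → Summable fun k => |c k| * R ^ k) (q : ℝ),
    ContDiffOn ℝ d (halfSeries c q) (Set.Ioi 0) := by
  induction d with
  | zero =>
    intro c hc q
    rw [Nat.cast_zero, contDiffOn_zero]
    exact fun z hz => (hasDerivAt_halfSeries hc q hz).continuousAt.continuousWithinAt
  | succ d ih =>
    intro c hc q
    rw [Nat.cast_succ, contDiffOn_succ_iff_deriv_of_isOpen isOpen_Ioi]
    refine ⟨fun z hz => (hasDerivAt_halfSeries hc q hz).differentiableAt.differentiableWithinAt,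
      fun h => by simp at h, ?_⟩
    exact (ih (fun R hR => summable_mul_linear hc q hR) (q - 1)).congr
      fun z hz => (hasDerivAt_halfSeries hc q hz).deriv

theorem iteratedDeriv_halfSeries {c : ℕ → ℝ}
    (hc : ∀ R : ℝ, 0 < R → Summable fun k => |c k| * R ^ k) (q : ℝ) (j : ℕ) :
    (∀ R : ℝ, 0 < R →
      Summable fun k => |c k * ∏ i ∈ Finset.range j, (q + k / 2 - i)| * R ^ k) ∧
    ∀ z : ℝ, 0 < z → iteratedDeriv j (halfSeries c q) z =
      halfSeries (fun k => c k * ∏ i ∈ Finset.range j, (q + k / 2 - i)) (q - j) z := by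
  induction j with
  | zero => simpa using hc
  | succ j ih =>
    have e : (fun k : ℕ => c k * ∏ i ∈ Finset.range (j + 1), (q + k / 2 - i)) =
        fun k => (c k * ∏ i ∈ Finset.range j, (q + k / 2 - i)) * (q - j + k / 2) := by
      ext k
      rw [Finset.prod_range_succ]; ring
    refine ⟨fun R hR => ?_, fun z hz => ?_⟩
    · simp only [fun k => congrFun e k]
      exact summable_mul_linear ih.1 (q - j) hR
    · rw [iteratedDeriv_succ, e, Nat.cast_succ, ← sub_sub]
      have : iteratedDeriv j (halfSeries c q) =ᶠ[𝓝 z]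
          halfSeries (fun k => c k * ∏ i ∈ Finset.range j, (q + k / 2 - i)) (q - j) := by
        filter_upwards [Ioi_mem_nhds hz] with y hy using ih.2 y hy
      rw [this.deriv_eq]
      exact (hasDerivAt_halfSeries ih.1 (q - j) hz).deriv

/-- These are the factors produced by differentiating `z^(p+j)` exactly `j` times. -/
theorem prod_range_sub_eq (p : ℝ) (j : ℕ) :
    ∏ i ∈ Finset.range j, (p + j - i) = j.factorial * binom (p + 1 + j - 1) j := by
  rw [choose_eq_ascPochhammer, ← descPochhammer_eval_eq_prod_range,
    descPochhammer_eval_eq_ascPochhammer]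
  congr 1; ring

/-! ### Expectations of power series in a bounded positive random variable. -/

section Moments

variable {Ω : Type*} [MeasurableSpace Ω] {P : Measure Ω} [IsProbabilityMeasure P]
  {V : Ω → ℝ} {B : ℝ}

theorem norm_rpow_le_of_bound {v b B : ℝ} (h0 : 0 < v) (hB : v ≤ B) (hb : 0 ≤ b) :
    ‖v ^ b‖ ≤ B ^ b := by
  rw [Real.norm_of_nonneg (by positivity)]
  exact Real.rpow_le_rpow h0.le hB hb

theorem integrable_rpow_of_bound (hV : AEMeasurable V P) (h0 : ∀ᵐ ω ∂P, 0 < V ω)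
    (hB : ∀ᵐ ω ∂P, V ω ≤ B) {b : ℝ} (hb : 0 ≤ b) : Integrable (fun ω => V ω ^ b) P := by
  refine Integrable.of_bound (hV.pow_const b).aestronglyMeasurable (B ^ b) ?_
  filter_upwards [h0, hB] with ω h1 h2 using norm_rpow_le_of_bound h1 h2 hb

theorem abs_integral_rpow_le (h0 : ∀ᵐ ω ∂P, 0 < V ω) (hB : ∀ᵐ ω ∂P, V ω ≤ B) {b : ℝ}
    (hb : 0 ≤ b) : |∫ ω, V ω ^ b ∂P| ≤ B ^ b := by
  have := norm_integral_le_of_norm_le_const (μ := P) (f := fun ω => V ω ^ b) (C := B ^ b) (by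
    filter_upwards [h0, hB] with ω h1 h2 using norm_rpow_le_of_bound h1 h2 hb)
  simpa using this

/-- The bound `0 < V ≤ B` gives the majorant `B^b |c_k| B^k`. Integrability of the sum is included
because it is needed again for the outer interchange. -/
theorem hasSum_integral_series (hV : AEMeasurable V P) (h0 : ∀ᵐ ω ∂P, 0 < V ω)
    (hB : ∀ᵐ ω ∂P, V ω ≤ B) (hB0 : 0 < B) {b : ℝ} (hb : 0 ≤ b) {c : ℕ → ℝ}
    (hc : Summable fun k => |c k| * B ^ k) {f : Ω → ℝ}
    (hf : ∀ᵐ ω ∂P, HasSum (fun k : ℕ => c k * V ω ^ (b + k)) (f ω)) :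
    Integrable f P ∧ HasSum (fun k : ℕ => c k * ∫ ω, V ω ^ (b + k) ∂P) (∫ ω, f ω ∂P) := by
  have hbk : ∀ k : ℕ, 0 ≤ b + k := fun k => by positivity
  have hint : ∀ k : ℕ, Integrable (fun ω => c k * V ω ^ (b + k)) P := fun k =>
    (integrable_rpow_of_bound hV h0 hB (hbk k)).const_mul _
  have hbound : ∀ k : ℕ, ∀ v : ℝ, 0 < v → v ≤ B →
      ‖c k * v ^ (b + k)‖ ≤ B ^ b * (|c k| * B ^ k) := by
    intro k v h1 h2
    rw [norm_mul, Real.norm_eq_abs (c k)]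
    calc _ ≤ |c k| * B ^ (b + k) := by
          gcongr
          exact norm_rpow_le_of_bound h1 h2 (hbk k)
      _ = _ := by rw [Real.rpow_add hB0, Real.rpow_natCast]; ring
  have hs : Summable fun k => B ^ b * (|c k| * B ^ k) := hc.mul_left _
  have hsn : Summable fun k : ℕ => ∫ ω, ‖c k * V ω ^ (b + k)‖ ∂P := by
    refine Summable.of_nonneg_of_le (fun k => by positivity) (fun k => ?_) hs
    have := norm_integral_le_of_norm_le_const (μ := P) (f := fun ω => ‖c k * V ω ^ (b + k)‖)
      (C := B ^ b * (|c k| * B ^ k)) (by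
        filter_upwards [h0, hB] with ω h1 h2
        rw [norm_norm]
        exact hbound k _ h1 h2)
    rw [probReal_univ, mul_one] at this
    exact (le_abs_self _).trans this
  refine ⟨?_, ?_⟩
  · refine Integrable.of_bound (C := ∑' k, B ^ b * (|c k| * B ^ k)) ?_ ?_
    · refine aestronglyMeasurable_of_tendsto_ae (u := atTop)
        (f := fun N ω => ∑ k ∈ Finset.range N, c k * V ω ^ (b + k)) (fun N => ?_) ?_
      · exact (integrable_finsetSum _ fun k _ => hint k).aestronglyMeasurable
      · filter_upwards [hf] with ω h using h.tendsto_sum_nat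
    · filter_upwards [hf, h0, hB] with ω h h1 h2
      rw [← h.tsum_eq]
      exact tsum_of_norm_bounded hs.hasSum fun k => hbound k _ h1 h2
  · have h := hasSum_integral_of_summable_integral_norm hint hsn
    refine hasSum_of_eq h (fun k => (integral_const_mul _ _).symm) (integral_congr_ae ?_)
    filter_upwards [hf] with ω h using h.tsum_eq.symm

theorem hasSum_integral_gammaCdf (hV : AEMeasurable V P) (h0 : ∀ᵐ ω ∂P, 0 < V ω)
    (hB : ∀ᵐ ω ∂P, V ω ≤ B) (hB0 : 0 < B) {b : ℝ} (hb : 0 < b) {r : ℝ} (hr : 0 ≤ r) :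
    HasSum (fun k : ℕ => (-1) ^ k * r ^ (b + k) / ((b + k) * k.factorial) *
        ∫ ω, V ω ^ (b + k) ∂P)
      (Real.Gamma b * ∫ ω, gammaCdf b (r * V ω) ∂P) := by
  have hc : Summable fun k : ℕ =>
      |(-1) ^ k * r ^ (b + k) / ((b + k) * k.factorial)| * B ^ k := by
    refine (((hasSum_gammaCdf hb (x := r * B) (by positivity)).summable.abs).mul_left
      (B ^ (-b))).congr fun k => ?_
    rw [Real.mul_rpow hr hB0.le, abs_div, abs_div, abs_mul, abs_mul, abs_mul (_ ^ k) (r ^ (b + k)),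
      abs_of_pos (by positivity : 0 < B ^ (b + k)), Real.rpow_add hB0, Real.rpow_natCast,
      Real.rpow_neg hB0.le]
    have : B ^ b ≠ 0 := by positivity
    field_simp
  have h := (hasSum_integral_series hV h0 hB hB0 hb.le hc
    (f := fun ω => Real.Gamma b * gammaCdf b (r * V ω)) (by
      filter_upwards [h0] with ω h1
      refine hasSum_of_eq (hasSum_gammaCdf hb (x := r * V ω) (by positivity)) (fun k => ?_) rfl
      rw [Real.mul_rpow hr h1.le]; ring)).2
  rwa [integral_const_mul] at h

theorem summable_innerSeries {a x : ℝ} (ha : 0 < a) (hx : 0 ≤ x) (j : ℕ) :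
    Summable fun k : ℕ =>
      |(-1) ^ k * x ^ (a + k) / ((a + k) * k.factorial) * binom ((a + k) / 2 + j - 1) j| := by
  refine Summable.of_nonneg_of_le (fun k => abs_nonneg _) (fun k => ?_)
    ((summable_choose_mul_pow ha hx j).mul_left (x ^ a / a))
  have hb := choose_nonneg (p := (a + k) / 2) (by positivity) j
  rw [abs_mul, abs_div, abs_mul, abs_pow, abs_neg, abs_one, one_pow, one_mul, abs_of_nonneg hb,
    abs_of_nonneg (by positivity : 0 ≤ x ^ (a + k)),
    abs_of_pos (by positivity : 0 < (a + k) * k.factorial)]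
  have e : x ^ (a + k) = x ^ a * x ^ k := by
    rw [Real.rpow_add_of_nonneg hx ha.le (by positivity), Real.rpow_natCast]
  rw [e]
  have hak : a ≤ a + k := by linarith [Nat.cast_nonneg (α := ℝ) k]
  calc x ^ a * x ^ k / ((a + k) * k.factorial) * binom ((a + k) / 2 + j - 1) j
      ≤ x ^ a * x ^ k / (a * k.factorial) * binom ((a + k) / 2 + j - 1) j := by gcongr
    _ = _ := by field_simp

theorem hasSum_integral_innerSeries (hV : AEMeasurable V P) (h0 : ∀ᵐ ω ∂P, 0 < V ω)
    (hB : ∀ᵐ ω ∂P, V ω ≤ B) (hB0 : 0 < B) {a : ℝ} (ha : 0 < a) {r : ℝ} (hr : 0 ≤ r) (j : ℕ) :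
    Integrable (fun ω => V ω ^ (2 * j) * innerSeries a j (r * V ω)) P ∧
    HasSum (fun k : ℕ => (-1) ^ k * r ^ (a + k) / ((a + k) * k.factorial) *
        binom ((a + k) / 2 + j - 1) j * ∫ ω, V ω ^ (a + (2 * j + k : ℕ)) ∂P)
      (∫ ω, V ω ^ (2 * j) * innerSeries a j (r * V ω) ∂P) := by
  have hc : Summable fun k : ℕ => |(-1) ^ k * r ^ (a + k) / ((a + k) * k.factorial) *
      binom ((a + k) / 2 + j - 1) j| * B ^ k := by
    refine ((summable_innerSeries ha (x := r * B) (by positivity) j).mul_left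
      (B ^ (-a))).congr fun k => ?_
    rw [Real.mul_rpow hr hB0.le, abs_mul, abs_mul, abs_div, abs_div, abs_mul, abs_mul,
      abs_mul (_ ^ k) (r ^ (a + k)),
      abs_of_pos (by positivity : 0 < B ^ (a + k)), Real.rpow_add hB0, Real.rpow_natCast,
      Real.rpow_neg hB0.le]
    have : B ^ a ≠ 0 := by positivity
    field_simp
  have h := hasSum_integral_series hV h0 hB hB0 (b := a + 2 * j) (by positivity) hc
    (f := fun ω => V ω ^ (2 * j) * innerSeries a j (r * V ω)) (by
      filter_upwards [h0] with ω h1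
      refine hasSum_of_eq (((summable_innerSeries ha (x := r * V ω) (by positivity)
        j).of_abs.hasSum).mul_left _) (fun k => ?_) rfl
      rw [Real.mul_rpow hr h1.le, show a + 2 * j + k = a + k + (2 * j : ℕ) by push_cast; ring,
        Real.rpow_add h1 (a + k), Real.rpow_natCast]
      ring)
  refine ⟨h.1, hasSum_of_eq h.2 (fun k => ?_) rfl⟩
  congr 2; ext ω
  congr 1; push_cast; ring

end Moments

/-! ### The three series have the same outer terms. -/

/-- The ratio `√n cos Φ` of the coordinate sum to the Euclidean norm. -/
def diagRatio {n : ℕ} (x : Fin n → ℝ) : ℝ := √(n : ℝ) * Real.cos (diagAngle x)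

section Terms

variable {Ω : Type*} [MeasurableSpace Ω] {P : Measure Ω} {n : ℕ}
  {X : Fin n → Ω → ℝ} {α : ℝ}

/-- The common value of the `j`-th terms of the three outer series. -/
def outerTerm (P : Measure Ω) (X : Fin n → Ω → ℝ) (α : ℝ) (j : ℕ) (r : ℝ) : ℝ :=
  (Real.Gamma (α * n))⁻¹ * ((1 / (n : ℝ) ^ j) * ∫ ω, diagRatio (fun i => X i ω) ^ (2 * j) *
    innerSeries (α * n) j (r * diagRatio fun i => X i ω) ∂P)

theorem angleMoment_eq (k : ℕ) :
    angleMoment P X α k = ∫ ω, diagRatio (fun i => X i ω) ^ (α * n + k) ∂P := rfl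

theorem H_eq (m : ℕ) (r : ℝ) :
    H P X α m r = ∫ ω, gammaCdf (α * n + m) (r * diagRatio fun i => X i ω) ∂P := by
  simp only [H, diagRatio, mul_assoc]

theorem abs_angleMoment_le [IsProbabilityMeasure P]
    (h0 : ∀ᵐ ω ∂P, 0 < diagRatio fun i => X i ω)
    (hB : ∀ᵐ ω ∂P, diagRatio (fun i => X i ω) ≤ √n)
    (hn : 0 < n) (hα : 0 < α) (k : ℕ) :
    |angleMoment P X α k| ≤ √n ^ (α * n) * √n ^ k := by
  rw [angleMoment_eq, ← Real.rpow_natCast (√n) k, ← Real.rpow_add (by positivity)]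
  exact abs_integral_rpow_le h0 hB (by positivity)

theorem summable_powerTerm [IsProbabilityMeasure P]
    (h0 : ∀ᵐ ω ∂P, 0 < diagRatio fun i => X i ω)
    (hB : ∀ᵐ ω ∂P, diagRatio (fun i => X i ω) ≤ √n)
    (hn : 0 < n) (hα : 0 < α) (j : ℕ) {r : ℝ} (hr : 0 ≤ r) :
    Summable fun k : ℕ => powerTerm P X α j k r := by
  have ha : 0 < α * n := by positivity
  refine Summable.of_norm_bounded ((summable_choose_mul_pow ha (R := √n * r) (by positivity)
    j).mul_left (√n ^ (α * n) * √n ^ (2 * j) / (α * n))) fun k => ?_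
  have hb := choose_nonneg (p := (α * n + k) / 2) (by positivity) j
  have hM := abs_angleMoment_le h0 hB hn hα (2 * j + k)
  rw [powerTerm, Real.norm_eq_abs, abs_mul, abs_mul, abs_div, abs_div, abs_pow, abs_neg,
    abs_of_nonneg hr, abs_of_nonneg hb, Nat.abs_cast, abs_of_pos (by positivity : 0 < α * n + k)]
  have hak : α * n ≤ α * n + k := by linarith [Nat.cast_nonneg (α := ℝ) k]
  calc _ ≤ binom ((α * n + k) / 2 + j - 1) j *
        (√n ^ (α * n) * √n ^ (2 * j + k) / (α * n)) * (r ^ k / k.factorial) := by gcongr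
    _ = _ := by rw [pow_add, mul_pow]; ring

theorem hasSum_powerTerm [IsProbabilityMeasure P]
    (hV : AEMeasurable (fun ω => diagRatio fun i => X i ω) P)
    (h0 : ∀ᵐ ω ∂P, 0 < diagRatio fun i => X i ω)
    (hB : ∀ᵐ ω ∂P, diagRatio (fun i => X i ω) ≤ √n)
    (hn : 0 < n) (hα : 0 < α) (j : ℕ) {r : ℝ} (hr : 0 ≤ r) :
    HasSum (fun k : ℕ => r ^ (α * n) * powerTerm P X α j k r)
      (∫ ω, diagRatio (fun i => X i ω) ^ (2 * j) *
        innerSeries (α * n) j (r * diagRatio fun i => X i ω) ∂P) := by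
  have ha : 0 < α * n := by positivity
  refine hasSum_of_eq (hasSum_integral_innerSeries hV h0 hB (by positivity) ha hr j).2
    (fun k => ?_) rfl
  rw [Real.rpow_add_of_nonneg hr ha.le (by positivity), Real.rpow_natCast, powerTerm, neg_pow,
    angleMoment_eq]
  have : α * n + (k : ℝ) ≠ 0 := by positivity
  field_simp

theorem powerTerm_outer [IsProbabilityMeasure P]
    (hV : AEMeasurable (fun ω => diagRatio fun i => X i ω) P)
    (h0 : ∀ᵐ ω ∂P, 0 < diagRatio fun i => X i ω)
    (hB : ∀ᵐ ω ∂P, diagRatio (fun i => X i ω) ≤ √n)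
    (hn : 0 < n) (hα : 0 < α) (j : ℕ) {r : ℝ} (hr : 0 ≤ r) :
    r ^ (α * n) / Real.Gamma (α * n) * ((∑' k : ℕ, powerTerm P X α j k r) * (1 / (n : ℝ) ^ j)) =
      outerTerm P X α j r := by
  rw [outerTerm, ← (hasSum_powerTerm hV h0 hB hn hα j hr).tsum_eq, tsum_mul_left]
  ring

theorem summable_H_coeff [IsProbabilityMeasure P]
    (h0 : ∀ᵐ ω ∂P, 0 < diagRatio fun i => X i ω)
    (hB : ∀ᵐ ω ∂P, diagRatio (fun i => X i ω) ≤ √n)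
    (hn : 0 < n) (hα : 0 < α) (m : ℕ) {R : ℝ} (hR : 0 < R) :
    Summable fun k : ℕ => |(-1 : ℝ) ^ k / ((α * n + m + k) * k.factorial) *
      angleMoment P X α (m + k)| * R ^ k := by
  have ha : 0 < α * n := by positivity
  refine Summable.of_nonneg_of_le (fun k => by positivity) (fun k => ?_)
    ((Real.summable_pow_div_factorial (√n * R)).mul_left (√n ^ (α * n) * √n ^ m / (α * n)))
  have hM := abs_angleMoment_le h0 hB hn hα (m + k)
  rw [abs_mul, abs_div, abs_pow, abs_neg, abs_one, one_pow,
    abs_of_pos (by positivity : 0 < (α * n + m + k) * (k.factorial : ℝ))]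
  have hak : α * n ≤ α * n + m + k := by
    linarith [Nat.cast_nonneg (α := ℝ) k, Nat.cast_nonneg (α := ℝ) m]
  calc _ ≤ 1 / (α * n * k.factorial) * (√n ^ (α * n) * √n ^ (m + k)) * R ^ k := by gcongr
    _ = _ := by rw [pow_add, mul_pow]; field_simp

/-- Expresses `H` as a series in half-integer steps of the exponent of `z`, which can be
differentiated termwise to every order. -/
theorem H_sqrt_eq [IsProbabilityMeasure P]
    (hV : AEMeasurable (fun ω => diagRatio fun i => X i ω) P)
    (h0 : ∀ᵐ ω ∂P, 0 < diagRatio fun i => X i ω)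
    (hB : ∀ᵐ ω ∂P, diagRatio (fun i => X i ω) ≤ √n)
    (hn : 0 < n) (hα : 0 < α) (m : ℕ) {z : ℝ} (hz : 0 < z) :
    H P X α m (√z) = (Real.Gamma (α * n + m))⁻¹ *
      halfSeries (fun k => (-1 : ℝ) ^ k / ((α * n + m + k) * k.factorial) *
        angleMoment P X α (m + k)) ((α * n + m) / 2) z := by
  have hb : 0 < α * n + m := by positivity
  have h := hasSum_integral_gammaCdf hV h0 hB (by positivity) hb (Real.sqrt_nonneg z)
  rw [← H_eq] at h
  rw [eq_inv_mul_iff_mul_eq₀ (Real.Gamma_pos_of_pos hb).ne', ← h.tsum_eq, halfSeries]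
  congr 1; ext k
  have e : (√z) ^ (α * n + m + k) = z ^ ((α * n + m) / 2 + (k : ℝ) / 2) := by
    rw [Real.sqrt_eq_rpow, ← Real.rpow_mul hz.le]; congr 1; ring
  have e2 : ∫ ω, diagRatio (fun i => X i ω) ^ (α * n + m + k) ∂P = angleMoment P X α (m + k) := by
    rw [angleMoment_eq]; push_cast; simp only [add_assoc]
  rw [e, e2]
  ring

theorem contDiffOn_H_sqrt [IsProbabilityMeasure P]
    (hV : AEMeasurable (fun ω => diagRatio fun i => X i ω) P)
    (h0 : ∀ᵐ ω ∂P, 0 < diagRatio fun i => X i ω)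
    (hB : ∀ᵐ ω ∂P, diagRatio (fun i => X i ω) ≤ √n)
    (hn : 0 < n) (hα : 0 < α) (m d : ℕ) :
    ContDiffOn ℝ d (fun z => H P X α m (√z)) (Set.Ioi 0) := by
  have h := (contDiffOn_halfSeries d (fun R hR => summable_H_coeff h0 hB hn hα m hR)
    ((α * n + m) / 2)).const_smul (Real.Gamma (α * n + m))⁻¹
  exact h.congr fun z hz => H_sqrt_eq hV h0 hB hn hα m hz

/-- With `p = (αn + k)/2`, the derivative of order `j` lowers `z^(p+j)` to `z^p` and produces `j!
binom(p + j, j)`. By `mul_choose_succ` this is `j! (p + j)/p` times the coefficient in `powerTerm`;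
the factor `p + j` cancels the denominator `αn + 2j + k` of the series for `H`, up to the factor
`2`. -/
theorem taylorTerm_eq_outerTerm [IsProbabilityMeasure P]
    (hV : AEMeasurable (fun ω => diagRatio fun i => X i ω) P)
    (h0 : ∀ᵐ ω ∂P, 0 < diagRatio fun i => X i ω)
    (hB : ∀ᵐ ω ∂P, diagRatio (fun i => X i ω) ≤ √n)
    (hn : 0 < n) (hα : 0 < α) (j : ℕ) {r : ℝ} (hr : 0 < r) :
    taylorTerm P X α j (r ^ 2) = outerTerm P X α j r := by
  have hz : 0 < r ^ 2 := by positivity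
  set c : ℕ → ℝ := fun k => (-1 : ℝ) ^ k / ((α * n + (2 * j : ℕ) + k) * k.factorial) *
        angleMoment P X α (2 * j + k) with hc
  have hder : iteratedDeriv j (fun y => H P X α (2 * j) (√y)) (r ^ 2) =
      (Real.Gamma (α * n + (2 * j : ℕ)))⁻¹ *
        iteratedDeriv j (halfSeries c ((α * n + (2 * j : ℕ)) / 2)) (r ^ 2) := by
    rw [← iteratedDeriv_const_mul_field]
    refine Filter.EventuallyEq.iteratedDeriv_eq j ?_
    filter_upwards [Ioi_mem_nhds hz] with y hy using H_sqrt_eq hV h0 hB hn hα (2 * j) hy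
  rw [(iteratedDeriv_halfSeries (fun R hR => summable_H_coeff h0 hB hn hα (2 * j) hR)
    ((α * n + (2 * j : ℕ)) / 2) j).2 _ hz] at hder
  rw [taylorTerm, hder, ← powerTerm_outer hV h0 hB hn hα j hr.le, halfSeries]
  have hterm : ∀ k : ℕ, c k * (∏ i ∈ Finset.range j, ((α * n + (2 * j : ℕ)) / 2 + (k : ℝ) / 2 - i)) *
      (r ^ 2) ^ ((α * n + (2 * j : ℕ)) / 2 - (j : ℝ) + (k : ℝ) / 2) =
      j.factorial * r ^ (α * n) * powerTerm P X α j k r := by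
    intro k
    have e1 : (α * n + (2 * j : ℕ)) / 2 + (k : ℝ) / 2 = (α * n + k) / 2 + j := by push_cast; ring
    have e2 : (r ^ 2) ^ ((α * n + (2 * j : ℕ)) / 2 - (j : ℝ) + (k : ℝ) / 2) =
        r ^ (α * n) * r ^ k := by
      rw [← Real.rpow_natCast r 2, ← Real.rpow_mul hr.le, ← Real.rpow_natCast r k,
        ← Real.rpow_add hr]
      congr 1; push_cast; ring
    have h1 := mul_choose_succ ((α * n + k) / 2) j
    have h2 : binom ((α * n + k) / 2 + 1 + j - 1) j =
        (α * n + (2 * j : ℕ) + k) / (α * n + k) * binom ((α * n + k) / 2 + j - 1) j := by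
      have : α * n + (k : ℝ) ≠ 0 := by positivity
      rw [div_mul_eq_mul_div, eq_div_iff this]
      push_cast
      linear_combination 2 * h1
    rw [e1, e2, prod_range_sub_eq, h2, powerTerm, neg_pow, hc]
    have h3 : α * n + (k : ℝ) ≠ 0 := by positivity
    have h4 : α * n + (2 * j : ℕ) + (k : ℝ) ≠ 0 := by positivity
    field_simp
  rw [tsum_congr hterm, tsum_mul_left]
  have hG : Real.Gamma (α * n + 2 * j) ≠ 0 := (Real.Gamma_pos_of_pos (by positivity)).ne'
  have hf : (j.factorial : ℝ) ≠ 0 := by positivity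
  push_cast
  field_simp

/-- Resummation at `x = λr` undoes the differences. The powers of `λ` then cancel apart from
`λ^(-2j)`, which the outer factor `(λ²/n)^j` compensates. -/
theorem hasSum_mixtureTerm [IsProbabilityMeasure P]
    (hV : AEMeasurable (fun ω => diagRatio fun i => X i ω) P)
    (h0 : ∀ᵐ ω ∂P, 0 < diagRatio fun i => X i ω)
    (hB : ∀ᵐ ω ∂P, diagRatio (fun i => X i ω) ≤ √n)
    (hn : 0 < n) (hα : 0 < α) (j : ℕ) {r lam : ℝ} (hr : 0 ≤ r)
    (hl : 0 < lam) :
    (Summable fun k : ℕ => mixtureTerm P X α lam j k r) ∧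
      (∑' k : ℕ, mixtureTerm P X α lam j k r) * (lam ^ 2 / n) ^ j = outerTerm P X α j r := by
  have ha : 0 < α * n := by positivity
  set d : ℕ → ℝ := fun l => binom ((α * n + l) / 2 + j - 1) j *
    (angleMoment P X α (2 * j + l) / lam ^ (α * n + 2 * j + l)) with hd
  have hpow : ∀ l : ℕ, lam ^ (α * n + 2 * j + l) = lam ^ (α * n) * lam ^ (2 * j) * lam ^ l := by
    intro l
    rw [Real.rpow_add hl, Real.rpow_add hl, Real.rpow_natCast]
    norm_cast
  have hs : Summable fun l : ℕ => |d l| * (lam * r) ^ l / l.factorial := by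
    refine Summable.of_nonneg_of_le (fun k => by positivity) (fun l => ?_)
      ((summable_choose_mul_pow ha (R := √n * r) (by positivity) j).mul_left
        (√n ^ (α * n) * √n ^ (2 * j) / (lam ^ (α * n) * lam ^ (2 * j))))
    have hb := choose_nonneg (p := (α * n + l) / 2) (by positivity) j
    have hM := abs_angleMoment_le h0 hB hn hα (2 * j + l)
    rw [hd]
    simp only
    rw [abs_mul, abs_div, abs_of_nonneg hb,
      abs_of_pos (a := lam ^ (α * n + 2 * j + l)) (by positivity), hpow]
    calc _ ≤ binom ((α * n + l) / 2 + j - 1) j * (√n ^ (α * n) * √n ^ (2 * j + l) /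
          (lam ^ (α * n) * lam ^ (2 * j) * lam ^ l)) * (lam * r) ^ l / l.factorial := by gcongr
      _ = _ := by rw [pow_add, mul_pow, mul_pow]; field_simp
  have h := hasSum_altDiff_gammaCdf ha (x := lam * r) (by positivity) d hs
  have hm : ∀ k : ℕ, mixtureTerm P X α lam j k r =
      (∑ l ∈ Finset.range (k + 1), (-1 : ℝ) ^ l * (k.choose l : ℝ) * d l) *
        binom (α * n + k - 1) k * gammaCdf (α * n + k) (lam * r) := by
    intro k
    rw [mixtureTerm, altDiff]
    simp only [hd, mul_assoc]
  have h' := hasSum_of_eq h hm rfl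
  refine ⟨h'.summable, ?_⟩
  rw [h'.tsum_eq, outerTerm, ← (hasSum_powerTerm hV h0 hB hn hα j hr).tsum_eq]
  rw [mul_assoc]
  congr 1
  rw [← tsum_mul_right, ← tsum_mul_left]
  refine tsum_congr fun l => ?_
  rw [hd]
  simp only
  rw [hpow, powerTerm, Real.mul_rpow hl.le hr, Real.rpow_add hl, Real.rpow_natCast,
    Real.rpow_add_of_nonneg hr ha.le (by positivity), Real.rpow_natCast, neg_pow r, div_pow, ← pow_mul]
  have h3 : α * n + (l : ℝ) ≠ 0 := by positivity
  field_simp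

end Terms

/-! ### Independence of the sum and the direction of a gamma sample. -/

theorem lintegral_fin_prod {n : ℕ} {E : Type*} [MeasurableSpace E] {μ : Measure E} [SigmaFinite μ]
    (ν : Fin n → Measure E) [∀ i, SigmaFinite (ν i)] {f : Fin n → E → ℝ≥0∞}
    (hf : ∀ i, Measurable (f i)) :
    ∫⁻ x, ∏ i, f i (x i) ∂Measure.pi ν = ∏ i, ∫⁻ x, f i x ∂ν i := by
  induction n with
  | zero => simp
  | succ n ih =>
    have hmp := (measurePreserving_piFinSuccAbove ν 0).symm
    rw [← hmp.lintegral_comp_emb (MeasurableEquiv.measurableEmbedding _)]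
    simp only [MeasurableEquiv.piFinSuccAbove_symm_apply, Fin.insertNthEquiv,
      Fin.prod_univ_succ, Fin.insertNth_zero, Equiv.coe_fn_mk, Fin.cons_succ, Fin.cons_zero,
      Fin.zero_succAbove]
    rw [← ih (fun i => ν i.succ) (fun i => hf i.succ)]
    have hm : Measurable fun x : Fin n → E => ∏ i, f i.succ (x i) := by fun_prop
    exact lintegral_prod_mul (hf 0).aemeasurable hm.aemeasurable

theorem pi_withDensity_eq {n : ℕ} {g : ℝ → ℝ≥0∞} (hg : Measurable g)
    [SigmaFinite ((volume : Measure ℝ).withDensity g)] :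
    Measure.pi (fun _ : Fin n => (volume : Measure ℝ).withDensity g) =
      (volume : Measure (Fin n → ℝ)).withDensity fun x => ∏ i, g (x i) := by
  refine Measure.pi_eq fun s hs => ?_
  rw [withDensity_apply _ (MeasurableSet.univ_pi hs), volume_pi, Measure.restrict_pi_pi,
    lintegral_fin_prod (μ := volume) _ fun _ => hg]
  exact Finset.prod_congr rfl fun i _ => (withDensity_apply _ (hs i)).symm

theorem lintegral_comp_smul {n : ℕ} {f : (Fin n → ℝ) → ℝ≥0∞} (hf : Measurable f) {s : ℝ}
    (hs : 0 < s) : ∫⁻ x, f (s • x) = ENNReal.ofReal (s ^ n)⁻¹ * ∫⁻ x, f x := by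
  rw [← lintegral_map hf (measurable_const_smul s), Measure.map_addHaar_smul _ hs.ne',
    lintegral_smul_measure, Module.finrank_fin_fun, abs_of_pos (by positivity), smul_eq_mul]

theorem lintegral_Ioi_comp_mul {f : ℝ → ℝ≥0∞} (hf : Measurable f) {s : ℝ} (hs : 0 < s) :
    ∫⁻ t in Set.Ioi 0, f t = ∫⁻ t in Set.Ioi 0, ENNReal.ofReal s * f (s * t) := by
  have hfi : Measurable ((Set.Ioi (0 : ℝ)).indicator f) := hf.indicator measurableSet_Ioi
  have h := lintegral_map (μ := volume) hfi (measurable_const_mul s)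
  rw [Real.map_volume_mul_left hs.ne', lintegral_smul_measure, abs_of_pos (by positivity),
    smul_eq_mul] at h
  rw [lintegral_const_mul _ (by fun_prop), ← lintegral_indicator measurableSet_Ioi,
    ← lintegral_indicator measurableSet_Ioi]
  have e : (Set.Ioi (0 : ℝ)).indicator (fun t => f (s * t)) =
      fun t => (Set.Ioi (0 : ℝ)).indicator f (s * t) := by
    ext t
    simp only [Set.indicator_apply, Set.mem_Ioi, mul_pos_iff_of_pos_left hs]
  rw [e, ← h, ← mul_assoc, ← ENNReal.ofReal_mul hs.le, mul_inv_cancel₀ hs.ne', ENNReal.ofReal_one,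
    one_mul]

/-- The joint law of `n` independent gamma variables. -/
abbrev gammaPi (n : ℕ) (α : ℝ) : Measure (Fin n → ℝ) := Measure.pi fun _ => gammaMeasure α 1

theorem measurable_gammaPDF (α : ℝ) : Measurable (gammaPDF α 1) :=
  (measurable_gammaPDFReal α 1).ennreal_ofReal

theorem gammaPi_eq {n : ℕ} {α : ℝ} (hα : 0 < α) :
    gammaPi n α = volume.withDensity fun x => ∏ i, gammaPDF α 1 (x i) := by
  have := isProbabilityMeasure_gammaMeasure hα one_pos
  have : SigmaFinite ((volume : Measure ℝ).withDensity (gammaPDF α 1)) :=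
    inferInstanceAs (SigmaFinite (gammaMeasure α 1))
  exact pi_withDensity_eq (measurable_gammaPDF α)

theorem isProbabilityMeasure_gammaPi {n : ℕ} {α : ℝ} (hα : 0 < α) :
    IsProbabilityMeasure (gammaPi n α) := by
  have := isProbabilityMeasure_gammaMeasure hα one_pos
  infer_instance

theorem ae_gammaMeasure_pos {α : ℝ} : ∀ᵐ x ∂gammaMeasure α 1, 0 < x := by
  have h0 : ∀ᵐ x ∂gammaMeasure α 1, x ≠ 0 :=
    (withDensity_absolutelyContinuous volume _).ae_le 
      (compl_mem_ae_iff.2 (measure_singleton (0 : ℝ)))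
  have h1 : ∀ᵐ x ∂gammaMeasure α 1, 0 ≤ x := by
    rw [gammaMeasure, ae_withDensity_iff (measurable_gammaPDF α)]
    refine ae_of_all _ fun x hx => ?_
    by_contra h
    exact hx (gammaPDF_of_neg (not_le.1 h))
  filter_upwards [h0, h1] with x h2 h3 using lt_of_le_of_ne h3 h2.symm

theorem ae_gammaPi_pos {n : ℕ} {α : ℝ} (hα : 0 < α) : ∀ᵐ x ∂gammaPi n α, ∀ i, 0 < x i := by
  have := isProbabilityMeasure_gammaMeasure hα one_pos
  rw [ae_all_iff]
  intro i
  exact (Measure.quasiMeasurePreserving_eval _ i).ae ae_gammaMeasure_pos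

theorem gammaPDF_div {α s : ℝ} (hs : 0 < s) (x : ℝ) :
    gammaPDF α 1 (s⁻¹ * x) = ENNReal.ofReal (s ^ (1 - α) * Real.exp (x - x / s)) * gammaPDF α 1 x := by
  rcases lt_or_ge x 0 with hx | hx
  · rw [gammaPDF_of_neg hx, gammaPDF_of_neg (mul_neg_of_pos_of_neg (by positivity) hx), mul_zero]
  · rw [gammaPDF_of_nonneg hx, gammaPDF_of_nonneg (by positivity),
      ← ENNReal.ofReal_mul (by positivity)]
    congr 1
    rw [Real.mul_rpow (by positivity) hx, Real.inv_rpow hs.le, ← Real.rpow_neg hs.le, neg_sub,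
      show Real.exp (-(1 * (s⁻¹ * x))) = Real.exp (x - x / s) * Real.exp (-(1 * x)) by
        rw [← Real.exp_add]; congr 1; ring]
    ring

/-- Scaling of the coordinates, expressed as a change of density. -/
theorem lintegral_gammaPi_comp_smul {n : ℕ} {α : ℝ} (hα : 0 < α) {f : (Fin n → ℝ) → ℝ≥0∞}
    (hf : Measurable f) {s : ℝ} (hs : 0 < s) :
    ∫⁻ x, f (s • x) ∂gammaPi n α = ∫⁻ x, f x *
      ENNReal.ofReal (s ^ (-(α * n)) * Real.exp ((∑ i, x i) - (∑ i, x i) / s)) ∂gammaPi n α := by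
  have hg := measurable_gammaPDF α
  have hD : Measurable fun x : Fin n → ℝ => ∏ i, gammaPDF α 1 (x i) := by fun_prop
  rw [gammaPi_eq hα, lintegral_withDensity_eq_lintegral_mul _ hD (by fun_prop),
    lintegral_withDensity_eq_lintegral_mul _ hD (by fun_prop)]
  have h := lintegral_comp_smul (n := n)
    (f := fun x => (∏ i, gammaPDF α 1 (s⁻¹ * x i)) * f x) (by fun_prop) hs
  simp only [Pi.smul_apply, smul_eq_mul, inv_mul_cancel_left₀ hs.ne'] at h
  simp only [Pi.mul_apply]
  rw [h, ← lintegral_const_mul _ (by fun_prop)]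
  refine lintegral_congr fun x => ?_
  simp only [gammaPDF_div hs]
  rw [Finset.prod_mul_distrib, ← ENNReal.ofReal_prod_of_nonneg (fun i _ => by positivity),
    Finset.prod_mul_distrib, ← Real.exp_sum, Finset.prod_const, Finset.card_univ, Fintype.card_fin,
    Finset.sum_sub_distrib, ← Finset.sum_div]
  -- The Jacobian `s^(-n)` and the `n` density factors `s^(1-α)` combine to `s^(-αn)`.
  have e : s ^ (-(α * n)) = (s ^ n)⁻¹ * (s ^ (1 - α)) ^ n := by
    rw [← Real.rpow_natCast s n, ← Real.rpow_neg hs.le, ← Real.rpow_mul_natCast hs.le,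
      ← Real.rpow_add hs]
    congr 1; ring
  rw [e, mul_assoc (s ^ n)⁻¹, ENNReal.ofReal_mul (p := (s ^ n)⁻¹) (by positivity)]
  ring

/-- The sum of independent gamma variables is a gamma variable which is independent of every scale
invariant function of them, up to the normalizing constant. -/
theorem lintegral_gammaPi_eq_const_mul {n : ℕ} (hn : 0 < n) {α : ℝ} (hα : 0 < α)
    {h : ℝ → (Fin n → ℝ) → ℝ≥0∞} (hh : Measurable (Function.uncurry h))
    (hinv : ∀ t x, ∀ c : ℝ, 0 < c → h t (c • x) = h t x) :
    ∫⁻ x, ∫⁻ t in Set.Ioi 0, h t x * ENNReal.ofReal (t ^ (α * n - 1) * Real.exp (-t)) ∂volume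
        ∂gammaPi n α =
      (∫⁻ s in Set.Ioi 0, ENNReal.ofReal (s ^ (-(α * n) - 1) * Real.exp (-(1 / s)))) *
        ∫⁻ x, h (∑ i, x i) x ∂gammaPi n α := by
  have := isProbabilityMeasure_gammaPi (n := n) hα
  have : Nonempty (Fin n) := ⟨⟨0, hn⟩⟩
  have hpos : ∀ᵐ x ∂gammaPi n α, 0 < ∑ i, x i := by
    filter_upwards [ae_gammaPi_pos hα] with x hx
    exact Finset.sum_pos (fun i _ => hx i) Finset.univ_nonempty
  have hT : Measurable fun x : Fin n → ℝ => ∑ i, x i := by fun_prop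
  have hm1 : ∀ x, Measurable fun t => h t x := fun x =>
    hh.comp (measurable_id.prodMk measurable_const)
  have hm2 : Measurable fun x : Fin n → ℝ => h (∑ i, x i) x :=
    hh.comp (hT.prodMk measurable_id)
  have hm3 : Measurable fun q : (Fin n → ℝ) × ℝ => h (q.2 * ∑ i, q.1 i) q.1 :=
    hh.comp (Measurable.prodMk (by fun_prop) measurable_fst)
  -- Substitute `t = s T` with `T` the coordinate sum. For fixed `s`, scaling the sample by `s`
  -- turns `h (s T) x` into `h T x` by invariance; a final substitution `s ↦ T s` removes `T` from
  -- the inner integral.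
  calc _ = ∫⁻ x, ∫⁻ s in Set.Ioi 0, h (s * ∑ i, x i) x * ENNReal.ofReal ((∑ i, x i) *
            ((s * ∑ i, x i) ^ (α * n - 1) * Real.exp (-(s * ∑ i, x i)))) ∂volume ∂gammaPi n α := by
        refine lintegral_congr_ae ?_
        filter_upwards [hpos] with x hx
        rw [lintegral_Ioi_comp_mul (by have := hm1 x; fun_prop) hx]
        refine lintegral_congr fun s => ?_
        rw [ENNReal.ofReal_mul (p := ∑ i, x i) hx.le, mul_comm (∑ i, x i) s]
        ring
    _ = ∫⁻ s in Set.Ioi 0, ∫⁻ x, h (s * ∑ i, x i) x * ENNReal.ofReal ((∑ i, x i) *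
            ((s * ∑ i, x i) ^ (α * n - 1) * Real.exp (-(s * ∑ i, x i)))) ∂gammaPi n α :=
        lintegral_lintegral_swap (by
          refine Measurable.aemeasurable ?_
          exact hm3.mul (by fun_prop))
    _ = ∫⁻ s in Set.Ioi 0, ∫⁻ x, h (∑ i, x i) x * ENNReal.ofReal ((∑ i, x i) ^ (α * n) *
            s ^ (-(α * n) - 1) * Real.exp (-((∑ i, x i) / s))) ∂gammaPi n α := by
        refine setLIntegral_congr_fun measurableSet_Ioi fun s (hs : 0 < s) => ?_
        have h1 := lintegral_gammaPi_comp_smul hα (n := n) (s := s)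
          (f := fun y => h (∑ i, y i) y * ENNReal.ofReal ((∑ i, y i) / s *
            ((∑ i, y i) ^ (α * n - 1) * Real.exp (-(∑ i, y i))))) (hm2.mul (by fun_prop)) hs
        simp only [Pi.smul_apply, smul_eq_mul, ← Finset.mul_sum, hinv _ _ s hs,
          mul_div_cancel_left₀ _ hs.ne'] at h1
        rw [h1]
        refine lintegral_congr_ae ?_
        filter_upwards [hpos] with x hx
        set T := ∑ i, x i
        rw [mul_assoc, ← ENNReal.ofReal_mul (by positivity)]
        congr 2
        rw [Real.rpow_sub_one hx.ne', Real.rpow_sub_one hs.ne', Real.exp_sub, Real.exp_neg,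
          Real.exp_neg]
        field_simp
    _ = ∫⁻ x, ∫⁻ s in Set.Ioi 0, h (∑ i, x i) x * ENNReal.ofReal ((∑ i, x i) ^ (α * n) *
            s ^ (-(α * n) - 1) * Real.exp (-((∑ i, x i) / s))) ∂volume ∂gammaPi n α := by
        refine (lintegral_lintegral_swap ?_).symm
        refine Measurable.aemeasurable ?_
        exact (hm2.comp measurable_fst).mul (by fun_prop)
    _ = ∫⁻ x, (∫⁻ s in Set.Ioi 0, ENNReal.ofReal (s ^ (-(α * n) - 1) * Real.exp (-(1 / s)))) *
          h (∑ i, x i) x ∂gammaPi n α := by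
        refine lintegral_congr_ae ?_
        filter_upwards [hpos] with x hx
        rw [lintegral_const_mul _ (by fun_prop), mul_comm]
        congr 1
        rw [lintegral_Ioi_comp_mul (by fun_prop) hx]
        refine setLIntegral_congr_fun measurableSet_Ioi fun s (hs : 0 < s) => ?_
        set T := ∑ i, x i
        rw [← ENNReal.ofReal_mul hx.le]
        congr 1
        rw [Real.mul_rpow hx.le hs.le, Real.rpow_sub_one hx.ne', Real.rpow_neg hx.le,
          show T / (T * s) = 1 / s by field_simp]
        have : T ^ (α * n) ≠ 0 := by positivity
        field_simp
    _ = _ := lintegral_const_mul _ hm2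

/-- The sum of independent gamma variables is a gamma variable which is independent of every scale
invariant function of them. -/
theorem lintegral_gammaPi_sum {n : ℕ} (hn : 0 < n) {α : ℝ} (hα : 0 < α)
    {h : ℝ → (Fin n → ℝ) → ℝ≥0∞} (hh : Measurable (Function.uncurry h))
    (hinv : ∀ t x, ∀ c : ℝ, 0 < c → h t (c • x) = h t x) :
    ∫⁻ x, h (∑ i, x i) x ∂gammaPi n α = ∫⁻ x, ∫⁻ t in Set.Ioi 0, h t x *
      ENNReal.ofReal (t ^ (α * n - 1) * Real.exp (-t) / Real.Gamma (α * n)) ∂volume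
        ∂gammaPi n α := by
  have := isProbabilityMeasure_gammaPi (n := n) hα
  have ha : 0 < α * n := by positivity
  have hG := Real.Gamma_pos_of_pos ha
  -- The case `h = 1` identifies the unknown constant as `Γ(αn)`.
  have h1 := lintegral_gammaPi_eq_const_mul hn hα (h := fun _ _ => 1) measurable_const
    (fun _ _ _ _ => rfl)
  have h2 := lintegral_gammaPi_eq_const_mul hn hα hh hinv
  simp only [one_mul, lintegral_const, measure_univ, mul_one] at h1
  have h3 : ∫⁻ t in Set.Ioi 0, ENNReal.ofReal (t ^ (α * n - 1) * Real.exp (-t)) =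
      ENNReal.ofReal (Real.Gamma (α * n)) := by
    rw [Real.Gamma_eq_integral ha, ofReal_integral_eq_lintegral_ofReal]
    · simp only [mul_comm]
    · exact Real.GammaIntegral_convergent ha
    · refine (ae_restrict_iff' measurableSet_Ioi).2 (ae_of_all _ fun t (ht : 0 < t) => ?_)
      positivity
  rw [← h1, h3] at h2
  have h4 : ∀ t x, h t x * ENNReal.ofReal (t ^ (α * n - 1) * Real.exp (-t) / Real.Gamma (α * n)) =
      (ENNReal.ofReal (Real.Gamma (α * n)))⁻¹ *
        (h t x * ENNReal.ofReal (t ^ (α * n - 1) * Real.exp (-t))) := by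
    intro t x
    rw [div_eq_inv_mul, ENNReal.ofReal_mul (by positivity), ENNReal.ofReal_inv_of_pos hG]
    ring
  simp only [h4]
  have hm : Measurable fun x => ∫⁻ t in Set.Ioi 0,
      h t x * ENNReal.ofReal (t ^ (α * n - 1) * Real.exp (-t)) :=
    Measurable.lintegral_prod_right' (f := fun q : (Fin n → ℝ) × ℝ =>
      h q.2 q.1 * ENNReal.ofReal (q.2 ^ (α * n - 1) * Real.exp (-q.2)))
      ((hh.comp measurable_swap).mul (by fun_prop))
  have hm1 : ∀ x, Measurable fun t => h t x := fun x =>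
    hh.comp (measurable_id.prodMk measurable_const)
  have hw : Measurable fun t : ℝ => ENNReal.ofReal (t ^ (α * n - 1) * Real.exp (-t)) := by fun_prop
  simp only [fun x => lintegral_const_mul (μ := volume.restrict (Set.Ioi (0 : ℝ)))
    (ENNReal.ofReal (Real.Gamma (α * n)))⁻¹ (f := fun t =>
      h t x * ENNReal.ofReal (t ^ (α * n - 1) * Real.exp (-t))) ((hm1 x).mul hw)]
  rw [lintegral_const_mul _ hm, h2, ← mul_assoc, ENNReal.inv_mul_cancel (by positivity)
    ENNReal.ofReal_ne_top, one_mul]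

/-! ### Geometry of the angle to the diagonal. -/

section Geometry

variable {n : ℕ}

theorem diagRatio_eq (hn : 0 < n) (x : Fin n → ℝ) :
    diagRatio x = (∑ i, x i) / √(∑ i, x i ^ 2) := by
  have h1 : ‖(WithLp.toLp 2 fun _ => 1 : EuclideanSpace ℝ (Fin n))‖ = √n := by
    simp [EuclideanSpace.norm_eq]
  have h2 : ‖(WithLp.toLp 2 x : EuclideanSpace ℝ (Fin n))‖ = √(∑ i, x i ^ 2) := by
    simp [EuclideanSpace.norm_eq]
  have h3 : inner ℝ (WithLp.toLp 2 x : EuclideanSpace ℝ (Fin n)) (WithLp.toLp 2 fun _ => 1) =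
      ∑ i, x i := by
    simp [PiLp.inner_apply]
  have : √(n : ℝ) ≠ 0 := by positivity
  rw [diagRatio, diagAngle, InnerProductGeometry.cos_angle, h1, h2, h3]
  field_simp

theorem measurable_diagRatio (hn : 0 < n) : Measurable (diagRatio : (Fin n → ℝ) → ℝ) := by
  rw [funext (diagRatio_eq hn)]
  fun_prop

theorem diagRatio_smul (hn : 0 < n) (x : Fin n → ℝ) {c : ℝ} (hc : 0 < c) :
    diagRatio (c • x) = diagRatio x := by
  simp only [diagRatio_eq hn, Pi.smul_apply, smul_eq_mul, mul_pow, ← Finset.mul_sum]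
  rw [Real.sqrt_mul (by positivity), Real.sqrt_sq hc.le, mul_div_mul_left _ _ hc.ne']

theorem sum_pos_of_pos (hn : 0 < n) {x : Fin n → ℝ} (hx : ∀ i, 0 < x i) : 0 < ∑ i, x i :=
  Finset.sum_pos (fun i _ => hx i) ⟨⟨0, hn⟩, Finset.mem_univ _⟩

theorem sum_sq_pos (hn : 0 < n) {x : Fin n → ℝ} (hx : ∀ i, 0 < x i) : 0 < ∑ i, x i ^ 2 :=
  Finset.sum_pos (fun i _ => by have := hx i; positivity) ⟨⟨0, hn⟩, Finset.mem_univ _⟩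

theorem diagRatio_pos (hn : 0 < n) {x : Fin n → ℝ} (hx : ∀ i, 0 < x i) : 0 < diagRatio x := by
  rw [diagRatio_eq hn]
  exact div_pos (sum_pos_of_pos hn hx) (Real.sqrt_pos.2 (sum_sq_pos hn hx))

theorem diagRatio_sq (hn : 0 < n) (x : Fin n → ℝ) :
    diagRatio x ^ 2 = (∑ i, x i) ^ 2 / ∑ i, x i ^ 2 := by
  rw [diagRatio_eq hn, div_pow, Real.sq_sqrt (Finset.sum_nonneg fun i _ => sq_nonneg _)]

theorem diagRatio_le (x : Fin n → ℝ) : diagRatio x ≤ √n :=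
  mul_le_of_le_one_right (Real.sqrt_nonneg _) (Real.cos_le_one _)

theorem diagRatio_sq_div_le_one (hn : 0 < n) (x : Fin n → ℝ) : diagRatio x ^ 2 / n ≤ 1 := by
  rw [diagRatio, mul_pow, Real.sq_sqrt (by positivity), mul_div_cancel_left₀ _ (by positivity)]
  nlinarith [Real.cos_sq_add_sin_sq (diagAngle x), sq_nonneg (Real.sin (diagAngle x))]

theorem sum_sub_mean_sq (hn : 0 < n) (x : Fin n → ℝ) :
    ∑ i, (x i - sampleMean x) ^ 2 = ∑ i, x i ^ 2 - (∑ i, x i) ^ 2 / n := by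
  have hn' : (n : ℝ) ≠ 0 := by positivity
  simp only [sub_sq, Finset.sum_add_distrib, Finset.sum_sub_distrib, ← Finset.sum_mul,
    ← Finset.mul_sum, Finset.sum_const, Finset.card_univ, Fintype.card_fin, nsmul_eq_mul]
  rw [sampleMean]
  field_simp
  ring

/-- With `T` the coordinate sum and `V = diagRatio x`, the identity `T² (1 - V²/n) = (n-1)S² · V²`
gives the equivalence after squaring; both sides of the second inequality are nonnegative. -/
theorem sampleVariance_le_iff (hn : 2 ≤ n) {x : Fin n → ℝ} (hx : ∀ i, 0 < x i)
    (hlt : diagRatio x ^ 2 / n < 1) {r : ℝ} (hr : 0 ≤ r) :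
    ((n : ℝ) - 1) * sampleVariance x ≤ r ^ 2 ↔
      ∑ i, x i ≤ r * diagRatio x / √(1 - diagRatio x ^ 2 / n) := by
  have hn0 : 0 < n := by omega
  have hn1 : (n : ℝ) - 1 ≠ 0 := by
    have : (2 : ℝ) ≤ n := by exact_mod_cast hn
    intro h; linarith
  have hV := diagRatio_pos hn0 hx
  have hT := sum_pos_of_pos hn0 hx
  have hN := sum_sq_pos hn0 hx
  have hw : 0 < 1 - diagRatio x ^ 2 / n := by linarith
  have hsq := diagRatio_sq hn0 x
  rw [sampleVariance, mul_inv_cancel_left₀ hn1, sum_sub_mean_sq hn0, le_div_iff₀ (by positivity),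
    ← pow_le_pow_iff_left₀ (a := (∑ i, x i) * _) (by positivity) (by positivity) two_ne_zero,
    mul_pow, mul_pow,
    Real.sq_sqrt hw.le]
  have hn' : (n : ℝ) ≠ 0 := by positivity
  have e : (∑ i, x i) ^ 2 * (1 - diagRatio x ^ 2 / n) =
      (∑ i, x i ^ 2 - (∑ i, x i) ^ 2 / n) * diagRatio x ^ 2 := by
    rw [hsq]; field_simp
  rw [e, mul_le_mul_iff_left₀ (by positivity)]

/-- The squared deviations sum to at most `ε ‖x‖² ≤ ε T²`, so every coordinate is within `√ε T` of
the mean. As `√ε ≤ 1/(8n)` with `n = m + 1`, the coordinate `x 0` is at least `7/8` of the mean,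
which replaces `T` by `2n x 0`. -/
theorem abs_sub_le_of_diagRatio {m : ℕ} {x : Fin (m + 1) → ℝ} (hx : ∀ i, 0 < x i) {ε : ℝ}
    (hε0 : 0 ≤ ε) (hε : ε ≤ 1 / (64 * ((m + 1 : ℕ) : ℝ) ^ 2))
    (h : 1 - diagRatio x ^ 2 / (m + 1 : ℕ) ≤ ε) (i : Fin (m + 1)) :
    |x i - x 0| ≤ 4 * (m + 1 : ℕ) * √ε * x 0 := by
  have hn0 : 0 < m + 1 := Nat.succ_pos m
  have hT := sum_pos_of_pos hn0 hx
  have hN := sum_sq_pos hn0 hx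
  set nn : ℝ := ((m + 1 : ℕ) : ℝ) with hnn
  have hnn0 : 0 < nn := by positivity
  set T := ∑ i, x i with hTd
  set N := ∑ i, x i ^ 2 with hNd
  have hNT : N ≤ T ^ 2 := by
    rw [pow_two, hTd, Finset.sum_mul]
    refine Finset.sum_le_sum fun i _ => ?_
    rw [pow_two]
    exact mul_le_mul_of_nonneg_left
      (Finset.single_le_sum (fun i _ => (hx i).le) (Finset.mem_univ i)) (hx i).le
  rw [diagRatio_sq hn0] at h
  have h1 : N - T ^ 2 / nn ≤ ε * N := by
    have e : N - T ^ 2 / nn = (1 - T ^ 2 / N / nn) * N := by field_simp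
    rw [e]
    exact mul_le_mul_of_nonneg_right h hN.le
  rw [← sum_sub_mean_sq hn0] at h1
  have h2 : ∀ i, |x i - T / nn| ≤ √ε * T := by
    intro i
    have := Finset.single_le_sum (f := fun i => (x i - sampleMean x) ^ 2)
      (fun i _ => sq_nonneg _) (Finset.mem_univ i)
    have h3 : (x i - T / nn) ^ 2 ≤ (√ε * T) ^ 2 := by
      rw [mul_pow, Real.sq_sqrt hε0]
      exact (this.trans h1).trans (mul_le_mul_of_nonneg_left hNT hε0)
    exact abs_le_of_sq_le_sq h3 (by positivity)
  have hδ : √ε ≤ 1 / (8 * nn) := by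
    rw [show (1 : ℝ) / (8 * nn) = √(1 / (64 * nn ^ 2)) by
      rw [show 1 / (64 * nn ^ 2) = (1 / (8 * nn)) ^ 2 by field_simp; norm_num,
        Real.sqrt_sq (by positivity)]]
    exact Real.sqrt_le_sqrt hε
  have h0 := abs_le.1 (h2 0)
  have hi := abs_le.1 (h2 i)
  have hδ0 : 0 ≤ √ε := Real.sqrt_nonneg _
  have hTx : T ≤ 2 * nn * x 0 := by
    have h4 : √ε * T ≤ 1 / (8 * nn) * T := by gcongr
    have h5 : T / nn - 1 / (8 * nn) * T ≤ x 0 := by linarith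
    have h6 : T / nn - 1 / (8 * nn) * T = 7 / 8 * T / nn := by field_simp; norm_num
    rw [h6, div_le_iff₀ hnn0] at h5
    nlinarith
  calc |x i - x 0| ≤ 2 * √ε * T := by rw [abs_le]; constructor <;> linarith
    _ ≤ 2 * √ε * (2 * nn * x 0) := by gcongr
    _ = _ := by ring

end Geometry

/-! ### Probability of being close to the diagonal, and decay of moments. -/

section TailBound

variable {α : ℝ}

/-- The density at `y` is at most a constant over `y`, also when `α < 1`. On the window `y ≥ x/2`,
so the length `2κx` cancels the `x` and the bound is uniform in `x`. -/
theorem exists_gammaMeasure_window_le (hα : 0 < α) : ∃ C : ℝ, 0 < C ∧ ∀ κ x : ℝ, 0 ≤ κ → κ ≤ 1 / 2 →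
    0 < x → gammaMeasure α 1 {y | |y - x| ≤ κ * x} ≤ ENNReal.ofReal (C * κ) := by
  obtain ⟨K, hK0, hK⟩ := exists_rpow_mul_exp_le α hα.le
  have hG := Real.Gamma_pos_of_pos hα
  refine ⟨4 * K / Real.Gamma α, by positivity, fun κ x hκ0 hκ hx => ?_⟩
  have hset : {y | |y - x| ≤ κ * x} = Set.Icc (x - κ * x) (x + κ * x) := by
    ext y
    rw [Set.mem_ofPred_eq, abs_le, Set.mem_Icc]
    constructor <;> rintro ⟨h1, h2⟩ <;> constructor <;> linarith
  rw [hset, gammaMeasure, withDensity_apply _ measurableSet_Icc]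
  calc ∫⁻ y in Set.Icc (x - κ * x) (x + κ * x), gammaPDF α 1 y
      ≤ ∫⁻ y in Set.Icc (x - κ * x) (x + κ * x),
          ENNReal.ofReal (2 * K / (Real.Gamma α * x)) := by
        refine setLIntegral_mono measurable_const fun y hy => ?_
        have hyx : x / 2 ≤ y := by nlinarith [hy.1]
        have hy0 : 0 < y := by linarith
        rw [gammaPDF_of_nonneg hy0.le]
        apply ENNReal.ofReal_le_ofReal
        have h1 := hK (2 * y) (by positivity)
        have h2 : y ^ α * Real.exp (-y) ≤ K := by
          refine le_trans ?_ h1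
          rw [show -(2 * y / 2) = -y by ring]
          gcongr
          nlinarith [sq_nonneg (2 * y - 1)]
        rw [Real.one_rpow, one_mul, Real.rpow_sub_one hy0.ne']
        calc 1 / Real.Gamma α * (y ^ α / y) * Real.exp (-y)
            = (y ^ α * Real.exp (-y)) / (Real.Gamma α * y) := by field_simp
          _ ≤ K / (Real.Gamma α * (x / 2)) := by gcongr
          _ = _ := by field_simp
    _ = _ := by
        rw [setLIntegral_const, Real.volume_Icc, ← ENNReal.ofReal_mul (by positivity)]
        congr 1
        field_simp
        ring

/-- Condition on the coordinate of index `0`; the other `m` are independent, and each meets its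
window with probability at most `Cκ`. -/
theorem exists_gammaPi_window_le (hα : 0 < α) (m : ℕ) : ∃ C : ℝ, 0 < C ∧ ∀ κ : ℝ, 0 ≤ κ →
    κ ≤ 1 / 2 → gammaPi (m + 1) α {x | ∀ i : Fin m, |x i.succ - x 0| ≤ κ * x 0} ≤
      ENNReal.ofReal ((C * κ) ^ m) := by
  have := isProbabilityMeasure_gammaMeasure hα one_pos
  obtain ⟨C, hC0, hC⟩ := exists_gammaMeasure_window_le hα
  refine ⟨C, hC0, fun κ hκ0 hκ => ?_⟩
  set S : Set (ℝ × (Fin m → ℝ)) := {q | ∀ i : Fin m, |q.2 i - q.1| ≤ κ * q.1} with hS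
  have hSm : MeasurableSet S := by
    rw [hS, Set.ofPred_forall]
    exact MeasurableSet.iInter fun i => measurableSet_le (by fun_prop) (by fun_prop)
  have hmp := measurePreserving_piFinSuccAbove (fun _ : Fin (m + 1) => gammaMeasure α 1) 0
  have e : {x : Fin (m + 1) → ℝ | ∀ i : Fin m, |x i.succ - x 0| ≤ κ * x 0} =
      (MeasurableEquiv.piFinSuccAbove (fun _ => ℝ) 0) ⁻¹' S := by
    ext x
    simp [hS, MeasurableEquiv.piFinSuccAbove, Fin.insertNthEquiv, Fin.tail]
  rw [e, hmp.measure_preimage hSm.nullMeasurableSet, Measure.prod_apply hSm]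
  calc _ ≤ ∫⁻ _, ENNReal.ofReal ((C * κ) ^ m) ∂gammaMeasure α 1 := by
        refine lintegral_mono_ae ?_
        filter_upwards [ae_gammaMeasure_pos] with a ha
        have e2 : Prod.mk a ⁻¹' S = Set.univ.pi fun _ : Fin m => {y | |y - a| ≤ κ * a} := by
          ext y
          simp [hS]
        rw [e2, Measure.pi_pi, Finset.prod_const, Finset.card_univ, Fintype.card_fin,
          ENNReal.ofReal_pow (by positivity)]
        gcongr
        exact hC κ a hκ0 hκ ha
    _ = _ := by simp

theorem exists_gammaPi_diagRatio_le (hα : 0 < α) (m : ℕ) : ∃ C : ℝ, 0 < C ∧ ∀ ε : ℝ, 0 ≤ ε →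
    gammaPi (m + 1) α {x | 1 - diagRatio x ^ 2 / (m + 1 : ℕ) ≤ ε} ≤
      ENNReal.ofReal (C * √ε ^ m) := by
  have := isProbabilityMeasure_gammaPi (n := m + 1) hα
  obtain ⟨C, hC0, hC⟩ := exists_gammaPi_window_le hα m
  set nn : ℝ := ((m + 1 : ℕ) : ℝ) with hnn
  have hnn0 : 0 < nn := by positivity
  -- The second summand serves small `ε`, with `κ = 4n√ε ≤ 1/2`; the first makes the bound at least
  -- `1` for the remaining `ε`.
  refine ⟨(8 * nn) ^ m + (C * (4 * nn)) ^ m, by positivity, fun ε hε0 => ?_⟩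
  have hδ0 : 0 ≤ √ε := Real.sqrt_nonneg _
  have hroot : √(1 / (64 * nn ^ 2)) = 1 / (8 * nn) := by
    rw [show 1 / (64 * nn ^ 2) = (1 / (8 * nn)) ^ 2 by field_simp; norm_num,
      Real.sqrt_sq (by positivity)]
  rcases le_total ε (1 / (64 * nn ^ 2)) with hε | hε
  · have hδ : √ε ≤ 1 / (8 * nn) := hroot ▸ Real.sqrt_le_sqrt hε
    have h1 := hC (4 * nn * √ε) (by positivity) (by
      calc 4 * nn * √ε ≤ 4 * nn * (1 / (8 * nn)) := by gcongr
        _ = 1 / 2 := by field_simp; norm_num)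
    calc _ ≤ gammaPi (m + 1) α {x | ∀ i : Fin m, |x i.succ - x 0| ≤ 4 * nn * √ε * x 0} := by
          refine measure_mono_ae ?_
          filter_upwards [ae_gammaPi_pos hα] with x hx h i
          exact abs_sub_le_of_diagRatio hx hε0 hε h i.succ
      _ ≤ ENNReal.ofReal ((C * (4 * nn * √ε)) ^ m) := h1
      _ ≤ _ := by
          apply ENNReal.ofReal_le_ofReal
          have : 0 ≤ (8 * nn) ^ m * √ε ^ m := by positivity
          rw [← mul_assoc, mul_pow, add_mul]
          linarith
  · refine prob_le_one.trans ?_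
    rw [← ENNReal.ofReal_one]
    apply ENNReal.ofReal_le_ofReal
    have hδ : 1 / (8 * nn) ≤ √ε := hroot ▸ Real.sqrt_le_sqrt hε
    have h1 : 1 ≤ (8 * nn * √ε) ^ m := by
      apply one_le_pow₀
      rw [div_le_iff₀ (by positivity)] at hδ
      linarith
    have : 0 ≤ (C * (4 * nn)) ^ m * √ε ^ m := by positivity
    rw [add_mul, ← mul_pow]
    linarith

/-- The case `ε = 0` of the diagonal estimate, whose exponent `m = n - 1` is positive. -/
theorem ae_diagRatio_lt (hα : 0 < α) {n : ℕ} (hn : 2 ≤ n) :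
    ∀ᵐ x ∂gammaPi n α, diagRatio x ^ 2 / n < 1 := by
  obtain ⟨m, rfl⟩ : ∃ m, n = m + 1 := ⟨n - 1, by omega⟩
  obtain ⟨C, hC0, hC⟩ := exists_gammaPi_diagRatio_le hα m
  have h := hC 0 le_rfl
  rw [Real.sqrt_zero, zero_pow (by omega), mul_zero, ENNReal.ofReal_zero, nonpos_iff_eq_zero] at h
  rw [ae_iff]
  refine measure_mono_null (fun x hx => ?_) h
  rw [Set.mem_ofPred_eq, not_lt] at hx
  rw [Set.mem_ofPred_eq]
  linarith

/-- Cut the range of `u` into layers of width `1/j`: with `i = ⌊ju⌋`, `(1 - u)^j ≤ exp(-ju) ≤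
exp(-i)` and `u ≤ (i + 1)/j`. Integrated, this turns small-ball probabilities into moment bounds. -/
theorem one_sub_pow_le_tsum {u : ℝ} (hu0 : 0 ≤ u) (hu1 : u ≤ 1) {j : ℕ} (hj : 1 ≤ j) :
    ENNReal.ofReal ((1 - u) ^ j) ≤ ∑' i : ℕ, ENNReal.ofReal (Real.exp (-i)) *
      {v : ℝ | v ≤ (i + 1) / j}.indicator 1 u := by
  have hj0 : (0 : ℝ) < j := by exact_mod_cast hj
  have h1 : (1 - u) ^ j ≤ Real.exp (-⌊j * u⌋₊) := by
    calc (1 - u) ^ j ≤ Real.exp (-u) ^ j := by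
          gcongr
          linarith [Real.add_one_le_exp (-u)]
      _ = Real.exp (-(j * u)) := by rw [← Real.exp_nat_mul]; congr 1; ring
      _ ≤ _ := by
          gcongr
          exact Nat.floor_le (by positivity)
  have h2 : u ∈ {v : ℝ | v ≤ ((⌊j * u⌋₊ : ℝ) + 1) / j} := by
    rw [Set.mem_ofPred_eq, le_div_iff₀ hj0, mul_comm]
    exact (Nat.lt_floor_add_one _).le
  refine le_trans ?_ (ENNReal.le_tsum ⌊j * u⌋₊)
  rw [Set.indicator_of_mem h2, Pi.one_apply, mul_one]
  exact ENNReal.ofReal_le_ofReal h1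

theorem summable_exp_mul_sqrt_pow (m : ℕ) :
    Summable fun i : ℕ => Real.exp (-i) * √((i : ℝ) + 1) ^ m := by
  have h := (summable_nat_add_iff 1).2 (Real.summable_pow_mul_exp_neg_nat_mul m one_pos)
  refine Summable.of_nonneg_of_le (fun i => by positivity) (fun i => ?_)
    (h.mul_left (Real.exp 1))
  have h1 : √((i : ℝ) + 1) ≤ i + 1 := by
    rw [Real.sqrt_le_left (by positivity)]
    nlinarith [Nat.cast_nonneg (α := ℝ) i]
  have e : Real.exp 1 * (((i + 1 : ℕ) : ℝ) ^ m * Real.exp (-1 * ((i + 1 : ℕ) : ℝ))) =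
      Real.exp (-i) * ((i : ℝ) + 1) ^ m := by
    push_cast
    rw [show Real.exp (-(i : ℝ)) = Real.exp 1 * Real.exp (-1 * ((i : ℝ) + 1)) by
      rw [← Real.exp_add]; congr 1; ring]
    ring
  rw [e]
  gcongr

/-- Decay of the moments of `cos² Φ`. -/
theorem exists_integral_diagRatio_pow_le (hα : 0 < α) {n : ℕ} (hn : 2 ≤ n) : ∃ C : ℝ, 0 < C ∧
    ∀ j : ℕ, 1 ≤ j → ∫ x, (diagRatio x ^ 2 / n) ^ j ∂gammaPi n α ≤
      C * (j : ℝ) ^ (-((n : ℝ) - 1) / 2) := by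
  have hn0 : 0 < n := by omega
  have := isProbabilityMeasure_gammaPi (n := n) hα
  have hmeas := measurable_diagRatio hn0
  obtain ⟨m, rfl⟩ : ∃ m, n = m + 1 := ⟨n - 1, by omega⟩
  obtain ⟨C, hC0, hC⟩ := exists_gammaPi_diagRatio_le hα m
  have hs := summable_exp_mul_sqrt_pow m
  set S := ∑' i : ℕ, Real.exp (-i) * √((i : ℝ) + 1) ^ m with hS
  have hS0 : 0 < S := hs.tsum_pos (fun i => by positivity) 0 (by positivity)
  refine ⟨C * S, by positivity, fun j hj => ?_⟩
  have hj0 : (0 : ℝ) < j := by exact_mod_cast hj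
  have hpow : (√(j : ℝ) ^ m)⁻¹ = (j : ℝ) ^ (-(((m + 1 : ℕ) : ℝ) - 1) / 2) := by
    rw [Real.sqrt_eq_rpow, ← Real.rpow_mul_natCast hj0.le, ← Real.rpow_neg hj0.le]
    congr 1; push_cast; ring
  rw [integral_eq_lintegral_of_nonneg_ae (ae_of_all _ fun x => by positivity)
    (by fun_prop : Measurable fun x : Fin (m + 1) → ℝ =>
      (diagRatio x ^ 2 / ((m + 1 : ℕ) : ℝ)) ^ j).aestronglyMeasurable]
  refine ENNReal.toReal_le_of_le_ofReal (by positivity) ?_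
  have hmeas' : Measurable fun x : Fin (m + 1) → ℝ => 1 - diagRatio x ^ 2 / ((m + 1 : ℕ) : ℝ) := by
    fun_prop
  have hset : ∀ i : ℕ, MeasurableSet {v : ℝ | v ≤ (i + 1) / j} := fun i => measurableSet_Iic
  have hind : ∀ i : ℕ, Measurable fun x : Fin (m + 1) → ℝ =>
      {v : ℝ | v ≤ (i + 1) / j}.indicator (1 : ℝ → ℝ≥0∞)
        (1 - diagRatio x ^ 2 / ((m + 1 : ℕ) : ℝ)) :=
    fun i => (measurable_one.indicator (hset i)).comp hmeas'
  calc ∫⁻ x, ENNReal.ofReal ((diagRatio x ^ 2 / ((m + 1 : ℕ) : ℝ)) ^ j) ∂gammaPi (m + 1) α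
      ≤ ∫⁻ x, ∑' i : ℕ, ENNReal.ofReal (Real.exp (-i)) * {v : ℝ | v ≤ (i + 1) / j}.indicator 1
          (1 - diagRatio x ^ 2 / ((m + 1 : ℕ) : ℝ)) ∂gammaPi (m + 1) α := by
        refine lintegral_mono fun x => ?_
        have h1 := diagRatio_sq_div_le_one hn0 x
        have h2 : 0 ≤ diagRatio x ^ 2 / ((m + 1 : ℕ) : ℝ) := by positivity
        have := one_sub_pow_le_tsum (u := 1 - diagRatio x ^ 2 / ((m + 1 : ℕ) : ℝ))
          (by linarith) (by linarith) hj
        rwa [sub_sub_cancel] at this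
    _ = ∑' i : ℕ, ENNReal.ofReal (Real.exp (-i)) *
          gammaPi (m + 1) α {x | 1 - diagRatio x ^ 2 / (m + 1 : ℕ) ≤ (i + 1) / j} := by
        rw [lintegral_tsum fun i => ((hind i).const_mul _).aemeasurable]
        refine tsum_congr fun i => ?_
        rw [lintegral_const_mul _ (hind i)]
        congr 1
        exact lintegral_indicator_one (hmeas' (hset i))
    _ ≤ ∑' i : ℕ, ENNReal.ofReal (C * (√(j : ℝ) ^ m)⁻¹ * (Real.exp (-i) * √((i : ℝ) + 1) ^ m)) := by
        refine ENNReal.tsum_le_tsum fun i => ?_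
        refine (mul_le_mul_right (hC ((i + 1) / j) (by positivity)) _).trans_eq ?_
        rw [← ENNReal.ofReal_mul (by positivity), Real.sqrt_div (by positivity), div_pow]
        congr 1; ring
    _ = _ := by
        rw [← ENNReal.ofReal_tsum_of_nonneg (fun i => by positivity) (hs.mul_left _),
          tsum_mul_left, ← hpow]
        congr 1; ring

end TailBound

/-! ### The cdf of the sum of squares as an expectation of gamma cdfs. -/

theorem continuous_gammaCdf {a : ℝ} (ha : 0 < a) : Continuous (gammaCdf a) := by
  unfold gammaCdf
  refine intervalIntegral.continuous_primitive (fun u v => ?_) 0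
  exact ((intervalIntegral.intervalIntegrable_rpow' (by linarith)).mul_continuousOn
    (by fun_prop)).div_const _

theorem gammaCdf_nonneg {a x : ℝ} (ha : 0 < a) (hx : 0 ≤ x) : 0 ≤ gammaCdf a x := by
  refine intervalIntegral.integral_nonneg hx fun ξ hξ => ?_
  have := hξ.1
  have := Real.Gamma_pos_of_pos ha
  positivity

theorem lintegral_gammaCdf {a x : ℝ} (ha : 0 < a) (hx : 0 ≤ x) :
    ∫⁻ t in Set.Ioi 0, (Set.Iic x).indicator 1 t *
      ENNReal.ofReal (t ^ (a - 1) * Real.exp (-t) / Real.Gamma a) = ENNReal.ofReal (gammaCdf a x) := by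
  have hG := Real.Gamma_pos_of_pos ha
  have e : ∀ t : ℝ, (Set.Iic x).indicator 1 t *
      ENNReal.ofReal (t ^ (a - 1) * Real.exp (-t) / Real.Gamma a) =
      (Set.Iic x).indicator
        (fun t => ENNReal.ofReal (t ^ (a - 1) * Real.exp (-t) / Real.Gamma a)) t := by
    intro t
    by_cases h : t ∈ Set.Iic x <;> simp [h]
  simp only [e]
  rw [lintegral_indicator measurableSet_Iic, Measure.restrict_restrict measurableSet_Iic,
    Set.inter_comm, Set.Ioi_inter_Iic, gammaCdf, intervalIntegral.integral_of_le hx,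
    ofReal_integral_eq_lintegral_ofReal]
  · exact (((intervalIntegrable_rpow_sub_one ha x).mul_continuousOn
      (by fun_prop)).div_const _).1
  · refine (ae_restrict_iff' measurableSet_Ioc).2 (ae_of_all _ fun t ht => ?_)
    have := ht.1
    simp only [Pi.zero_apply]
    positivity

theorem aestronglyMeasurable_gammaCdf_diagRatio {n : ℕ} (hn : 0 < n) {α : ℝ} (hα : 0 < α) (r : ℝ) :
    AEStronglyMeasurable (fun x : Fin n → ℝ => gammaCdf (α * n)
      (r * diagRatio x / √(1 - diagRatio x ^ 2 / n))) (gammaPi n α) := by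
  have h1 := measurable_diagRatio hn
  have h2 := (continuous_gammaCdf (a := α * n) (by positivity)).measurable
  exact (h2.comp (by fun_prop : Measurable fun x : Fin n → ℝ =>
    r * diagRatio x / √(1 - diagRatio x ^ 2 / n))).aestronglyMeasurable

/-- The cdf of the sum of squared deviations, conditioned on the direction of the sample. -/
theorem gammaPi_sampleVariance_le {n : ℕ} (hn : 2 ≤ n) {α : ℝ} (hα : 0 < α) {r : ℝ} (hr : 0 ≤ r) :
    (gammaPi n α).real {x | ((n : ℝ) - 1) * sampleVariance x ≤ r ^ 2} =
      ∫ x, gammaCdf (α * n) (r * diagRatio x / √(1 - diagRatio x ^ 2 / n)) ∂gammaPi n α := by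
  have hn0 : 0 < n := by omega
  have ha : 0 < α * n := by positivity
  set b : (Fin n → ℝ) → ℝ := fun x => r * diagRatio x / √(1 - diagRatio x ^ 2 / n) with hb
  have hmeas := measurable_diagRatio hn0
  have hbm : Measurable b := by fun_prop
  have hb0 : ∀ᵐ x ∂gammaPi n α, 0 ≤ b x := by
    filter_upwards [ae_gammaPi_pos hα] with x hx
    have := diagRatio_pos hn0 hx
    positivity
  -- The indicator of the event, with the sum as a separate argument `t`: the threshold `b` is scale
  -- invariant, so the independence statement applies.
  set h : ℝ → (Fin n → ℝ) → ℝ≥0∞ := fun t x => (Set.Iic (b x)).indicator 1 t with hh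
  have hset : MeasurableSet {q : ℝ × (Fin n → ℝ) | q.1 ≤ b q.2} :=
    measurableSet_le measurable_fst (hbm.comp measurable_snd)
  have hhm : Measurable (Function.uncurry h) := by
    have : Function.uncurry h = {q : ℝ × (Fin n → ℝ) | q.1 ≤ b q.2}.indicator 1 := by
      ext q
      rfl
    rw [this]
    exact measurable_one.indicator hset
  have hinv : ∀ t x, ∀ c : ℝ, 0 < c → h t (c • x) = h t x := by
    intro t x c hc
    simp only [hh, hb, diagRatio_smul hn0 x hc]
  have key := lintegral_gammaPi_sum hn0 hα hhm hinv
  have hS : MeasurableSet {x : Fin n → ℝ | ∑ i, x i ≤ b x} :=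
    measurableSet_le (by fun_prop) hbm
  have h1 : ∫⁻ x, h (∑ i, x i) x ∂gammaPi n α = gammaPi n α {x | ∑ i, x i ≤ b x} :=
    lintegral_indicator_one hS
  have h2 : ∫⁻ x, ∫⁻ t in Set.Ioi 0, h t x *
      ENNReal.ofReal (t ^ (α * n - 1) * Real.exp (-t) / Real.Gamma (α * n)) ∂volume ∂gammaPi n α =
      ∫⁻ x, ENNReal.ofReal (gammaCdf (α * n) (b x)) ∂gammaPi n α := by
    refine lintegral_congr_ae ?_
    filter_upwards [hb0] with x hx using lintegral_gammaCdf ha hx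
  rw [integral_eq_lintegral_of_nonneg_ae (by
      filter_upwards [hb0] with x hx using gammaCdf_nonneg ha hx)
    (aestronglyMeasurable_gammaCdf_diagRatio hn0 hα r), ← h2, ← key, h1, measureReal_def]
  congr 1
  refine measure_congr ?_
  filter_upwards [ae_gammaPi_pos hα, ae_diagRatio_lt hα hn] with x hx hlt
  exact propext (sampleVariance_le_iff hn hx hlt hr)

theorem measurableSet_sampleVariance_le (n : ℕ) (z : ℝ) :
    MeasurableSet {x : Fin n → ℝ | ((n : ℝ) - 1) * sampleVariance x ≤ z} := by
  unfold sampleVariance sampleMean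
  exact measurableSet_le (by fun_prop) measurable_const

/-! ### Convergence of the outer series and the theorem. -/

section Main

variable {Ω : Type*} [MeasurableSpace Ω] {P : Measure Ω} {n : ℕ} {X : Fin n → Ω → ℝ} {α : ℝ}

/-- The absolute value stands inside the integral, so that the bound serves both the interchange of
sum and expectation and the estimate of the terms. -/
theorem abs_outerTerm_le [IsProbabilityMeasure P]
    (hV : AEMeasurable (fun ω => diagRatio fun i => X i ω) P)
    (h0 : ∀ᵐ ω ∂P, 0 < diagRatio fun i => X i ω) (hn : 0 < n) (hα : 0 < α) {C D : ℝ} (hC : 0 < C)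
    (hCb : ∀ j : ℕ, 1 ≤ j → ∀ x : ℝ, 0 ≤ x → |innerSeries (α * n) j x| ≤ C / j)
    (hD : ∀ j : ℕ, 1 ≤ j → ∫ ω, (diagRatio (fun i => X i ω) ^ 2 / n) ^ j ∂P ≤
      D * (j : ℝ) ^ (-((n : ℝ) - 1) / 2)) {r : ℝ} (hr : 0 ≤ r) {j : ℕ} (hj : 1 ≤ j) :
    (Real.Gamma (α * n))⁻¹ * ((1 / (n : ℝ) ^ j) * ∫ ω, |diagRatio (fun i => X i ω) ^ (2 * j) *
        innerSeries (α * n) j (r * diagRatio fun i => X i ω)| ∂P) ≤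
      (Real.Gamma (α * n))⁻¹ * C * D * (j : ℝ) ^ (-((n : ℝ) + 1) / 2) := by
  have hj0 : (0 : ℝ) < j := by exact_mod_cast hj
  have hG := Real.Gamma_pos_of_pos (s := α * n) (by positivity)
  rw [mul_assoc, mul_assoc]
  refine mul_le_mul_of_nonneg_left ?_ (by positivity)
  have hint : Integrable (fun ω => (diagRatio (fun i => X i ω) ^ 2 / n) ^ j) P := by
    refine Integrable.of_bound (C := 1) ((hV.pow_const 2).div_const _ |>.pow_const
      j).aestronglyMeasurable (ae_of_all _ fun ω => ?_)
    rw [norm_pow, Real.norm_of_nonneg (by positivity)]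
    exact pow_le_one₀ (by positivity) (diagRatio_sq_div_le_one hn _)
  calc (1 / (n : ℝ) ^ j) * ∫ ω, |diagRatio (fun i => X i ω) ^ (2 * j) *
        innerSeries (α * n) j (r * diagRatio fun i => X i ω)| ∂P
      ≤ (1 / (n : ℝ) ^ j) * ∫ ω, (n : ℝ) ^ j * (C / j) *
          (diagRatio (fun i => X i ω) ^ 2 / n) ^ j ∂P := by
        refine mul_le_mul_of_nonneg_left ?_ (by positivity)
        refine integral_mono_of_nonneg (ae_of_all _ fun ω => abs_nonneg _) (hint.const_mul _) ?_
        filter_upwards [h0] with ω h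
        have h1 := hCb j hj (r * diagRatio fun i => X i ω) (by positivity)
        rw [abs_mul, abs_of_nonneg (by positivity : 0 ≤ diagRatio (fun i => X i ω) ^ (2 * j))]
        calc _ ≤ diagRatio (fun i => X i ω) ^ (2 * j) * (C / j) := by gcongr
          _ = _ := by rw [div_pow, ← pow_mul]; field_simp
    _ = C / j * ∫ ω, (diagRatio (fun i => X i ω) ^ 2 / n) ^ j ∂P := by
        rw [integral_const_mul]; field_simp
    _ ≤ C / j * (D * (j : ℝ) ^ (-((n : ℝ) - 1) / 2)) := by
        gcongr
        exact hD j hj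
    _ = _ := by
        rw [show -((n : ℝ) + 1) / 2 = -((n : ℝ) - 1) / 2 - 1 by ring, Real.rpow_sub_one hj0.ne']
        ring

theorem hasSum_outerTerm [IsProbabilityMeasure P]
    (hV : AEMeasurable (fun ω => diagRatio fun i => X i ω) P)
    (h0 : ∀ᵐ ω ∂P, 0 < diagRatio fun i => X i ω)
    (hlt : ∀ᵐ ω ∂P, diagRatio (fun i => X i ω) ^ 2 / n < 1)
    (hn : 2 ≤ n) (hα : 0 < α) {C D : ℝ} (hC : 0 < C)
    (hCb : ∀ j : ℕ, 1 ≤ j → ∀ x : ℝ, 0 ≤ x → |innerSeries (α * n) j x| ≤ C / j)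
    (hD : ∀ j : ℕ, 1 ≤ j → ∫ ω, (diagRatio (fun i => X i ω) ^ 2 / n) ^ j ∂P ≤
      D * (j : ℝ) ^ (-((n : ℝ) - 1) / 2)) {r : ℝ} (hr : 0 ≤ r) :
    HasSum (fun j => outerTerm P X α j r) (∫ ω, gammaCdf (α * n)
      (r * diagRatio (fun i => X i ω) / √(1 - diagRatio (fun i => X i ω) ^ 2 / n)) ∂P) := by
  have hn0 : 0 < n := by omega
  have ha : 0 < α * n := by positivity
  have hG := Real.Gamma_pos_of_pos ha
  have hB : ∀ᵐ ω ∂P, diagRatio (fun i => X i ω) ≤ √n := ae_of_all _ fun ω => diagRatio_le _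
  set F : ℕ → Ω → ℝ := fun j ω => (Real.Gamma (α * n))⁻¹ * ((1 / (n : ℝ) ^ j) *
    (diagRatio (fun i => X i ω) ^ (2 * j) *
      innerSeries (α * n) j (r * diagRatio fun i => X i ω))) with hF
  have hint : ∀ j, Integrable (F j) P := fun j =>
    ((hasSum_integral_innerSeries hV h0 hB (by positivity) ha hr j).1.const_mul _).const_mul _
  have hnorm : ∀ j, ∫ ω, ‖F j ω‖ ∂P = (Real.Gamma (α * n))⁻¹ * ((1 / (n : ℝ) ^ j) *
      ∫ ω, |diagRatio (fun i => X i ω) ^ (2 * j) *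
        innerSeries (α * n) j (r * diagRatio fun i => X i ω)| ∂P) := by
    intro j
    rw [← integral_const_mul, ← integral_const_mul]
    refine integral_congr_ae (ae_of_all _ fun ω => ?_)
    simp only [hF]
    rw [norm_mul, norm_mul, Real.norm_of_nonneg (by positivity), Real.norm_of_nonneg (by positivity),
      Real.norm_eq_abs]
  have hsum : Summable fun j => ∫ ω, ‖F j ω‖ ∂P := by
    -- The bounds hold only for `j ≥ 1`, hence the shift; the exponent `(n + 1)/2` exceeds `1`
    -- because `n ≥ 2`.
    rw [← summable_nat_add_iff 1]
    have hn2 : (2 : ℝ) ≤ n := by exact_mod_cast hn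
    have hp : Summable fun j : ℕ => (j : ℝ) ^ (-((n : ℝ) + 1) / 2) :=
      Real.summable_nat_rpow.2 (by linarith)
    refine Summable.of_nonneg_of_le (fun j => by positivity) (fun j => ?_)
      (((summable_nat_add_iff 1).2 hp).mul_left ((Real.Gamma (α * n))⁻¹ * C * D))
    rw [hnorm]
    exact abs_outerTerm_le hV h0 hn0 hα hC hCb hD hr (Nat.le_add_left 1 j)
  refine hasSum_of_eq (hasSum_integral_of_summable_integral_norm hint hsum) (fun j => ?_) ?_
  · simp only [hF]
    rw [integral_const_mul, integral_const_mul]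
    rfl
  · refine integral_congr_ae ?_
    filter_upwards [h0, hlt] with ω h1 h2
    have h := (hasSum_innerSeries ha (x := r * diagRatio fun i => X i ω)
      (w := diagRatio (fun i => X i ω) ^ 2 / n) (by positivity) (by positivity) h2).mul_left
      (Real.Gamma (α * n))⁻¹
    rw [inv_mul_cancel_left₀ hG.ne'] at h
    rw [← h.tsum_eq]
    refine tsum_congr fun j => ?_
    simp only [hF]
    rw [div_pow, ← pow_mul]
    ring

end Main

end

end GammaSample

open GammaSample
theorem theorem4p1 (n : ℕ) (hn : 2 ≤ n) (α : ℝ) (hα : 0 < α) :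
    -- the constant depends on `α` and `n` only
    ∃ C : ℝ, ∀ {Ω : Type*} [MeasurableSpace Ω] (P : Measure Ω) [IsProbabilityMeasure P]
      (X : Fin n → Ω → ℝ),
      (∀ i, HasLaw (X i) (gammaMeasure α 1) P) → iIndepFun X P →
      -- Taylor type series: the derivatives exist, the series converges absolutely to the cdf,
      -- and its terms are `O(j^(-(n+1)/2))`
      (∀ m d : ℕ, ContDiffOn ℝ d (fun z => H P X α m (√z)) (Set.Ioi 0)) ∧
      (∀ z r : ℝ, 0 < r → z = r ^ 2 →
        Summable (fun j : ℕ => |taylorTerm P X α j z|) ∧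
        HasSum (fun j : ℕ => taylorTerm P X α j z)
          (P.real {ω | ((n : ℝ) - 1) * sampleVariance (fun i => X i ω) ≤ z}) ∧
        ∀ j : ℕ, 1 ≤ j → |taylorTerm P X α j z| ≤ C * (j : ℝ) ^ (-((n : ℝ) + 1) / 2)) ∧
      -- double power series
      (∀ z r : ℝ, 0 ≤ r → z = r ^ 2 →
        (∀ j : ℕ, Summable fun k : ℕ => powerTerm P X α j k r) ∧
        HasSum (fun j : ℕ => r ^ (α * n) / Real.Gamma (α * n) *
            ((∑' k : ℕ, powerTerm P X α j k r) * (1 / (n : ℝ) ^ j)))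
          (P.real {ω | ((n : ℝ) - 1) * sampleVariance (fun i => X i ω) ≤ z})) ∧
      -- double series of gamma cdfs, for every scale factor
      (∀ z r lam : ℝ, 0 ≤ r → z = r ^ 2 → 0 < lam →
        (∀ j : ℕ, Summable fun k : ℕ => mixtureTerm P X α lam j k r) ∧
        HasSum (fun j : ℕ => (∑' k : ℕ, mixtureTerm P X α lam j k r) * (lam ^ 2 / n) ^ j)
          (P.real {ω | ((n : ℝ) - 1) * sampleVariance (fun i => X i ω) ≤ z})) := by
  have hn0 : 0 < n := by omega
  have ha : 0 < α * n := by positivity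
  have hG := Real.Gamma_pos_of_pos ha
  obtain ⟨C, hC, hCb⟩ := exists_abs_innerSeries_le ha
  obtain ⟨D, -, hD⟩ := exists_integral_diagRatio_pow_le hα hn
  -- `C` bounds deterministic coefficients and `D` moments under `gammaPi n α`, so the constant is
  -- fixed before the probability space and the sample.
  refine ⟨(Real.Gamma (α * n))⁻¹ * C * D, fun {Ω} _ P _ X hX hind => ?_⟩
  have hlaw : HasLaw (fun ω i => X i ω) (gammaPi n α) P := hind.hasLaw_pi hX
  have hmeas := measurable_diagRatio hn0
  have hV : AEMeasurable (fun ω => diagRatio fun i => X i ω) P :=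
    hmeas.comp_aemeasurable hlaw.aemeasurable
  have htrans : ∀ {p : (Fin n → ℝ) → Prop}, (∀ᵐ x ∂gammaPi n α, p x) →
      ∀ᵐ ω ∂P, p fun i => X i ω := fun hp =>
    ae_of_ae_map hlaw.aemeasurable (hlaw.map_eq ▸ hp)
  have h0 : ∀ᵐ ω ∂P, 0 < diagRatio fun i => X i ω :=
    htrans ((ae_gammaPi_pos hα).mono fun x hx => diagRatio_pos hn0 hx)
  have hlt : ∀ᵐ ω ∂P, diagRatio (fun i => X i ω) ^ 2 / n < 1 := htrans (ae_diagRatio_lt hα hn)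
  have hB : ∀ᵐ ω ∂P, diagRatio (fun i => X i ω) ≤ √n := ae_of_all _ fun ω => diagRatio_le _
  have hD' : ∀ j : ℕ, 1 ≤ j → ∫ ω, (diagRatio (fun i => X i ω) ^ 2 / n) ^ j ∂P ≤
      D * (j : ℝ) ^ (-((n : ℝ) - 1) / 2) := fun j hj =>
    (hlaw.integral_comp (f := fun x => (diagRatio x ^ 2 / n) ^ j)
      (by fun_prop : Measurable fun x : Fin n → ℝ =>
        (diagRatio x ^ 2 / (n : ℝ)) ^ j).aestronglyMeasurable).trans_le (hD j hj)
  have hcdf : ∀ r : ℝ, 0 ≤ r →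
      P.real {ω | ((n : ℝ) - 1) * sampleVariance (fun i => X i ω) ≤ r ^ 2} =
      ∫ ω, gammaCdf (α * n)
        (r * diagRatio (fun i => X i ω) / √(1 - diagRatio (fun i => X i ω) ^ 2 / n)) ∂P := by
    intro r hr
    rw [hlaw.measureReal_eq (p := fun x => ((n : ℝ) - 1) * sampleVariance x ≤ r ^ 2)
      (measurableSet_sampleVariance_le n _), gammaPi_sampleVariance_le hn hα hr]
    exact (hlaw.integral_comp (aestronglyMeasurable_gammaCdf_diagRatio hn0 hα r)).symm
  have hmain : ∀ r : ℝ, 0 ≤ r → HasSum (fun j => outerTerm P X α j r)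
      (P.real {ω | ((n : ℝ) - 1) * sampleVariance (fun i => X i ω) ≤ r ^ 2}) := fun r hr =>
    hcdf r hr ▸ hasSum_outerTerm hV h0 hlt hn hα hC hCb hD' hr
  refine ⟨fun m d => contDiffOn_H_sqrt hV h0 hB hn0 hα m d, ?_, ?_, ?_⟩
  · rintro z r hr rfl
    have hs := hasSum_of_eq (hmain r hr.le)
      (fun j => taylorTerm_eq_outerTerm hV h0 hB hn0 hα j hr) rfl
    refine ⟨hs.summable.abs, hs, fun j hj => ?_⟩
    rw [taylorTerm_eq_outerTerm hV h0 hB hn0 hα j hr]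
    refine le_trans ?_ (abs_outerTerm_le hV h0 hn0 hα hC hCb hD' hr.le hj)
    rw [outerTerm, abs_mul, abs_mul, abs_of_pos (inv_pos.2 hG), abs_of_pos (by positivity)]
    gcongr
    exact abs_integral_le_integral_abs
  · rintro z r hr rfl
    exact ⟨fun j => summable_powerTerm h0 hB hn0 hα j hr,
      hasSum_of_eq (hmain r hr) (fun j => powerTerm_outer hV h0 hB hn0 hα j hr) rfl⟩
  · rintro z r lam hr rfl hl
    exact ⟨fun j => (hasSum_mixtureTerm hV h0 hB hn0 hα j hr hl).1,
      hasSum_of_eq (hmain r hr) (fun j => (hasSum_mixtureTerm hV h0 hB hn0 hα j hr hl).2) rfl⟩
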